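/- Let $\mathbb T^1=\mathbb R/\mathbb Z$, let $\omega$ be irrational, and let $T:\mathbb T^2\to\mathbb T^2$, $T(\theta,x)=(\theta+\omega,T_\theta(x))$, be a quasiperiodically forced circle homeomorphism: $T$ is continuous, every fibre map $T_\theta$ is an orientation-preserving homeomorphism of $\mathbb T^1$, and $T$ is homotopic to the identity. For a lift $\widehat T(\theta,\hat x)=(\theta+\omega,\widehat T_\theta(\hat x))$ of $T$ to $\mathbb T^1\times\mathbb R$ let $\widehat T^n_\theta$ be the fibre maps of $\widehat T^n$ and let $\rho_{\widehat T}=\lim_{n\to\infty}\frac1n(\widehat T^n_\theta(\hat x)-\hat x)$ (the limit exists and does not depend on $(\theta,\hat x)$); the fibrewise rotation number is $\rho_T=\rho_{\widehat T}\bmod 1$, which does not depend on the lift. Suppose that $T$ is regular, i.e. all orbits are $\rho_T$-bounded: for every lift $\widehat T$ and every $(\theta,\hat x)$ there is $C>0$ with $|\widehat T^n_\theta(\hat x)-\hat x-n\rho_{\widehat T}|\le C$ for all $n\in\mathbb N$. Call $\omega$ and $\rho_T$ rationally dependent if $l+k\omega+q\rho_T=0$ (with real representatives) for some integers $(l,k,q)\ne(0,0,0)$,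 and rationally independent otherwise. Then: (a) If $\rho_T$ and $\omega$ are rationally dependent, there are integers $p,q\ge1$ such that $T$ has a $p,q$-invariant strip and a regular $p,q$-invariant graph. (b) If $\rho_T$ and $\omega$ are rationally independent, $T$ is semi-conjugate to the irrational torus translation $R_{\omega,\rho_T}(\theta,x)=(\theta+\omega,x+\rho_T)$: there is a continuous surjection $h:\mathbb T^2\to\mathbb T^2$ with $h\circ T=R_{\omega,\rho_T}\circ h$. Moreover $h$ can be chosen to be fibre-respecting, $\pi_1\circ h=\pi_1$, with all fibre maps $h_\theta$ order-preserving circle maps, i.e. $h_\theta$ has a continuous nondecreasing lift $g:\mathbb R\to\mathbb R$ with $g(x+1)=g(x)+1$. Here a $q$-curve is given by a continuous $\hat\gamma:\mathbb R\to\mathbb R$ with $\hat\gamma(t+q)=\hat\gamma(t)+k$ for some $k\in\mathbb Z$ and all $t$, and $\hat\gamma(t+l)-\hat\gamma(t)\notin\mathbb Z$ for all $t$ and $1\le l\le q-1$; above $t\bmod1$ it has the values $\gamma_j=\hat\gamma(t+j-1)\bmod 1$, $1\le j\le q$. A $1,q$-invariant open tube for a map $S$ of $\mathbb T^2$ is an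 open set $U$ with $S(U)=U$ for which there is a $q$-curve such that every fibre $U_\theta=\{x:(\theta,x)\in U\}$ consists of $q$ disjoint nonempty open intervals (each different from $\mathbb T^1$), the $j$-th containing $\gamma_j(\theta)$. A $p,q$-invariant open tube for $T$ is a set $U=\bigcup_{i=1}^pU^i$ where $U^1$ is a $1,q$-invariant open tube for $T^p$ and the sets $U^i=T^{i-1}(U^1)$ are pairwise disjoint. A $p,q$-invariant strip is a compact set $A$ with $T(A)=A$ whose complement is a $p,q$-invariant open tube. A regular $p,q$-invariant graph is a function $\varphi=(\varphi^i_j)_{1\le i\le p,1\le j\le q}$ on $\mathbb T^1$ with $pq$ distinct values in $\mathbb T^1$ at every $\theta$ that bounds a $p,q$-invariant open tube $U=\bigcup_i U^i$: for some $q$-curves $\gamma^i$ contained in $U^i$, labelled above $\theta$ through the representative $t\in[0,1)$ of $\theta$, either $\varphi^i_j(\theta)=\gamma^i_j(\theta)+\inf\{x\in[0,1):\gamma^i_j(\theta)+x\notin U_\theta\}$ for all $i,j,\theta$, or $\varphi^i_j(\theta)=\gamma^i_j(\theta)-\inf\{x\in[0,1):\gamma^i_j(\theta)-x\notin U_\theta\}$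 for all $i,j,\theta$. -/

import Mathlib

open Set Filter Topology

noncomputable section

namespace QPF

/-- The circle `ℝ / ℤ`. -/
abbrev Circ : Type := UnitAddCircle

/-- The two-dimensional torus; the first coordinate is the base, the second one the fibre. -/
abbrev Torus : Type := Circ × Circ

/-- An orientation-preserving homeomorphism of the circle: a homeomorphism having a nondecreasing
lift `g : ℝ → ℝ` with `g (x + 1) = g x + 1`. -/
def IsOrientationPreservingHomeo (f : Circ → Circ) : Prop :=
  IsHomeomorph f ∧ ∃ g : CircleDeg1Lift, ∀ x : ℝ, f (x : Circ) = ((g x : ℝ) : Circ)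

/-- An order-preserving circle map: a map of the circle having a continuous nondecreasing
lift `g : ℝ → ℝ` with `g (x + 1) = g x + 1`. -/
def IsOrderPreservingCircleMap (f : Circ → Circ) : Prop :=
  ∃ g : CircleDeg1Lift, Continuous g ∧ ∀ x : ℝ, f (x : Circ) = ((g x : ℝ) : Circ)

/-- A quasiperiodically forced circle homeomorphism homotopic to the identity. -/
structure ForcedCircleHomeo where
  /-- the rotation rate on the base -/
  ω : ℝ
  irrational_ω : Irrational ω
  /-- the map of the torus -/
  toMap : C(Torus, Torus)
  map_fst : ∀ z : Torus, (toMap z).1 = z.1 + (ω : Circ)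
  fibre_map : ∀ θ : Circ, IsOrientationPreservingHomeo fun x => (toMap (θ, x)).2
  homotopic_id : toMap.Homotopic (ContinuousMap.id Torus)

/-- The covering map from `Circ × ℝ` onto the torus. -/
def proj : C(Circ × ℝ, Torus) where
  toFun z := (z.1, (z.2 : Circ))
  continuous_toFun :=
    continuous_fst.prodMk ((AddCircle.continuous_mk' (1 : ℝ)).comp continuous_snd)

/-- `F` is a lift of `T` to `Circ × ℝ`. -/
def IsLift (T : C(Torus, Torus)) (F : C(Circ × ℝ, Circ × ℝ)) : Prop :=
  ∀ z, proj (F z) = T (proj z)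

/-- The fibrewise rotation number of a lift: the limit of `(F^n_θ(x) - x) / n`, taken along the
orbit of `(0, 0)` (it exists and does not depend on the point `(θ, x)`). -/
def liftRotationNumber (F : C(Circ × ℝ, Circ × ℝ)) : ℝ :=
  limUnder atTop fun n : ℕ => ((F^[n] (0, 0)).2 - 0) / (n : ℝ)

/-- The orbit of `z = (θ, x)` under the lift `F` is `ρ`-bounded. -/
def IsBoundedOrbit (F : C(Circ × ℝ, Circ × ℝ)) (ρ : ℝ) (z : Circ × ℝ) : Prop :=
  ∃ C : ℝ, ∀ n : ℕ, |(F^[n] z).2 - z.2 - n * ρ| ≤ C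

namespace ForcedCircleHomeo

/-- Every system homotopic to the identity has a lift to `Circ × ℝ`. -/
theorem exists_isLift (T : ForcedCircleHomeo) :
    ∃ F : C(Circ × ℝ, Circ × ℝ), IsLift T.toMap F := by
  obtain ⟨H⟩ := T.homotopic_id.symm
  let K : C(unitInterval × (Circ × ℝ), Circ) :=
    ⟨fun s => (H (s.1, proj s.2)).2, by fun_prop⟩
  let f : C(Circ × ℝ, ℝ) := ⟨Prod.snd, continuous_snd⟩
  have hK : ∀ a, K (0, a) = ((f a : ℝ) : Circ) := by
    intro a
    change (H (0, proj a)).2 = _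
    rw [H.apply_zero]
    rfl
  have cov : IsCoveringMap ((↑) : ℝ → Circ) := AddCircle.isCoveringMap_coe (1 : ℝ)
  let L := cov.liftHomotopy K f hK
  refine ⟨⟨fun z => ((T.toMap (proj z)).1, L (1, z)), by fun_prop⟩, fun z => ?_⟩
  have h := congrFun (cov.liftHomotopy_lifts K f hK) (1, z)
  refine Prod.ext rfl ?_
  change ((L (1, z) : ℝ) : Circ) = (T.toMap (proj z)).2
  refine h.trans ?_
  change (H (1, proj z)).2 = _
  rw [H.apply_one]

/-- A lift of `T`. -/
def someLift (T : ForcedCircleHomeo) : C(Circ × ℝ, Circ × ℝ) := T.exists_isLift.choose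

/-- The fibrewise rotation number `ρ_T` of `T`, an element of the circle: the rotation number
modulo `1` of a lift of `T` (the choice of the lift is immaterial). -/
def rotationNumber (T : ForcedCircleHomeo) : Circ :=
  ((liftRotationNumber T.someLift : ℝ) : Circ)

/-- `T` is regular: all orbits are `ρ_T`-bounded. -/
def IsRegular (T : ForcedCircleHomeo) : Prop :=
  ∀ F : C(Circ × ℝ, Circ × ℝ), IsLift T.toMap F →
    ∀ z, IsBoundedOrbit F (liftRotationNumber F) z

end ForcedCircleHomeo

/-- Two points of the circle are rationally dependent: representatives `a`, `b` satisfy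
`l + k a + q b = 0` for some integers `l, k, q`, not all zero. -/
def RationallyDependent (α β : Circ) : Prop :=
  ∃ a b : ℝ, (a : Circ) = α ∧ (b : Circ) = β ∧
    ∃ l k q : ℤ, (l, k, q) ≠ (0, 0, 0) ∧ (l : ℝ) + k * a + q * b = 0

/-- The torus translation `(θ, x) ↦ (θ + α, x + β)`. -/
def translation (α β : Circ) : Torus → Torus := fun z => (z.1 + α, z.2 + β)

/-- `h` is a semi-conjugacy of `T` to `S`. -/
def IsSemiconjugacy (h T S : Torus → Torus) : Prop :=
  Continuous h ∧ Function.Surjective h ∧ ∀ z, h (T z) = S (h z)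

/-- The fibre of a subset of the torus above `θ`. -/
def fibre (A : Set Torus) (θ : Circ) : Set Circ := {x | (θ, x) ∈ A}

/-- A nonempty open interval of the circle, different from the whole circle. -/
def IsOpenArc (I : Set Circ) : Prop :=
  ∃ a b : ℝ, a < b ∧ b ≤ a + 1 ∧ I = (fun x : ℝ => (x : Circ)) '' Ioo a b

/-- `γ : ℝ → ℝ` is a lift of a `q`-curve. The `q`-curve itself is the projection, whose `q` values
over the base point `t mod 1` are `γ (t + j) mod 1`, `j = 0, …, q - 1`. -/
def IsQCurve (q : ℕ) (γ : ℝ → ℝ) : Prop :=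
  Continuous γ ∧ (∃ k : ℤ, ∀ t : ℝ, γ (t + q) = γ t + k) ∧
    ∀ t : ℝ, ∀ l : ℕ, 1 ≤ l → l < q → ∀ n : ℤ, γ (t + l) - γ t ≠ n

/-- `U` is a `1,q`-invariant open tube for `S`: an open invariant set such that for some `q`-curve
`γ` each fibre of `U` consists of `q` disjoint nonempty open intervals, the `j`-th one of which
contains the `j`-th value of `γ`. -/
def IsOneTube (S : Torus → Torus) (q : ℕ) (U : Set Torus) : Prop :=
  IsOpen U ∧ S '' U = U ∧
    ∃ γ : ℝ → ℝ, IsQCurve q γ ∧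
      ∀ t : ℝ, ∃ I : Fin q → Set Circ,
        (∀ j, IsOpenArc (I j)) ∧ Pairwise (fun i j => Disjoint (I i) (I j)) ∧
        fibre U (t : Circ) = ⋃ j, I j ∧
        ∀ j : Fin q, ((γ (t + (j : ℕ)) : ℝ) : Circ) ∈ I j

/-- `V` is a `1,q`-invariant open tube for `T^p` whose images `V, T V, …, T^(p-1) V` are pairwise
disjoint. -/
def IsTubeComponent (T : Torus → Torus) (p q : ℕ) (V : Set Torus) : Prop :=
  0 < p ∧ 0 < q ∧ IsOneTube T^[p] q V ∧
    Pairwise fun i j : Fin p => Disjoint (T^[i] '' V) (T^[j] '' V)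

/-- The union of `V, T V, …, T^(p-1) V`. -/
def tubeOf (T : Torus → Torus) (p : ℕ) (V : Set Torus) : Set Torus :=
  ⋃ i : Fin p, T^[i] '' V

/-- `U` is a `p,q`-invariant open tube for `T`. -/
def IsInvariantTube (T : Torus → Torus) (p q : ℕ) (U : Set Torus) : Prop :=
  ∃ V, IsTubeComponent T p q V ∧ U = tubeOf T p V

/-- `A` is a `p,q`-invariant strip for `T`: a compact invariant set whose complement is a
`p,q`-invariant open tube. -/
def IsInvariantStrip (T : Torus → Torus) (p q : ℕ) (A : Set Torus) : Prop :=
  IsCompact A ∧ T '' A = A ∧ IsInvariantTube T p q Aᶜ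

/-- `φ` is a regular `p,q`-invariant graph for `T`: at each `θ` it takes `p q` distinct values, and
it is the (upper, or lower) bounding graph of a `p,q`-invariant open tube `U`, measured from
`q`-curves `γ i` contained in the components `U^i = T^i V` of `U`. -/
def IsRegularInvariantGraph (T : Torus → Torus) (p q : ℕ)
    (φ : Circ → Fin p → Fin q → Circ) : Prop :=
  (∀ θ, Function.Injective fun ij : Fin p × Fin q => φ θ ij.1 ij.2) ∧
  ∃ V, IsTubeComponent T p q V ∧
    ∃ γ : Fin p → ℝ → ℝ, (∀ i, IsQCurve q (γ i)) ∧
      (∀ i : Fin p, ∀ t : ℝ, ((t : Circ), ((γ i t : ℝ) : Circ)) ∈ T^[i] '' V) ∧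
      ((∀ t ∈ Ico (0 : ℝ) 1, ∀ (i : Fin p) (j : Fin q), φ (t : Circ) i j =
          ((γ i (t + (j : ℕ)) + sInf {x ∈ Ico (0 : ℝ) 1 |
            ((γ i (t + (j : ℕ)) + x : ℝ) : Circ) ∉ fibre (tubeOf T p V) (t : Circ)} : ℝ) : Circ)) ∨
       (∀ t ∈ Ico (0 : ℝ) 1, ∀ (i : Fin p) (j : Fin q), φ (t : Circ) i j =
          ((γ i (t + (j : ℕ)) - sInf {x ∈ Ico (0 : ℝ) 1 |
            ((γ i (t + (j : ℕ)) - x : ℝ) : Circ) ∉ fibre (tubeOf T p V) (t : Circ)} : ℝ) : Circ)))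

end QPF

end

noncomputable section

namespace QPF

/-! For a lift `Φ`, a Baire argument makes the orbit bounds uniform, so `supGraph (θ, y)`, the
supremum over `n : ℤ` of the fibre coordinates of `Φ^n (θ - nω, y - nρ)`, is finite. It is lower
semicontinuous, nondecreasing in `y`, compatible with integer translations, and equivariant: `Φ`
carries the value at `(θ, y)` to the value at `(θ + ω, y + ρ)`. It need not be continuous; the crux
is to separate its members strictly, even after passing to upper semicontinuous envelopes.

Suppose the envelope of one member reaches a higher member at some point. Equivariance propagates
this to a dense set of points, and semicontinuity to all points. A function and its envelope differ
by less than `ε` on a dense open set, so a finite chain of such contacts gains arbitrarily little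
height somewhere (`exists_lt_of_chain`). Yet enough steps make a full turn, which gains at least
`1`.

In the independent case, Kronecker's theorem gives the density (`upperEnvelope_supGraph_lt`), and
the generalized inverse `height` of `y ↦ supGraph (θ, y)` is continuous and descends to the
semi-conjugacy. In the dependent case, `pqρ = paω + b` in lowest terms, and `supGraph` is restricted
to the lines `y = at/q + j/(pq)`. Separation (`upperCurve_lt_curve`) leaves open gaps between
consecutive curves; these are permuted by the dynamics and project to `p` tubes, each winding `q`
times around the base. The curves bounding the gaps from above give the invariant graph. -/

theorem coe_eq_coe_iff {x y : ℝ} : (x : Circ) = (y : Circ) ↔ ∃ m : ℤ, x = y + m := by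
  rw [← sub_eq_zero, ← AddCircle.coe_sub, AddCircle.coe_eq_zero_iff]
  refine exists_congr fun m => ?_
  rw [zsmul_one, eq_sub_iff_add_eq, add_comm, eq_comm]

theorem coe_add_intCast (x : ℝ) (m : ℤ) : ((x + m : ℝ) : Circ) = (x : Circ) :=
  coe_eq_coe_iff.2 ⟨m, rfl⟩

theorem isOpenMap_proj : IsOpenMap proj :=
  IsOpenMap.prodMap IsOpenMap.id QuotientAddGroup.isOpenMap_coe

/-! ### Upper semicontinuous envelopes. -/

section Envelope

variable {X : Type*} [TopologicalSpace X]

/-- A real function is locally bounded above. -/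
def LocallyBddAbove (u : X → ℝ) : Prop := ∀ x, ∃ C, ∀ᶠ y in 𝓝 x, u y ≤ C

/-- The upper semicontinuous envelope of a function that is locally bounded above. -/
def upperEnvelope (u : X → ℝ) (x : X) : ℝ := sInf {s | ∀ᶠ y in 𝓝 x, u y ≤ s}

variable {u v : X → ℝ}

theorem upperEnvelope_le {x : X} {s : ℝ} (h : ∀ᶠ y in 𝓝 x, u y ≤ s) : upperEnvelope u x ≤ s :=
  csInf_le ⟨u x, fun _ hs => hs.self_of_nhds⟩ h

theorem LocallyBddAbove.eventually_lt (hu : LocallyBddAbove u) {x : X} {s : ℝ}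
    (h : upperEnvelope u x < s) : ∀ᶠ y in 𝓝 x, u y < s := by
  obtain ⟨r, hr, hrs⟩ := exists_lt_of_csInf_lt (hu x) h
  exact Filter.Eventually.mono hr fun y hy => lt_of_le_of_lt hy hrs

theorem LocallyBddAbove.le_upperEnvelope (hu : LocallyBddAbove u) (x : X) :
    u x ≤ upperEnvelope u x :=
  le_csInf (hu x) fun s hs => Filter.Eventually.self_of_nhds (p := fun y => u y ≤ s) hs

theorem LocallyBddAbove.eventually_upperEnvelope_lt (hu : LocallyBddAbove u) {x : X} {s : ℝ}
    (h : upperEnvelope u x < s) : ∀ᶠ y in 𝓝 x, upperEnvelope u y < s := by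
  obtain ⟨r, hr, hrs⟩ := exists_between h
  filter_upwards [eventually_eventually_nhds.2 (hu.eventually_lt hr)] with y hy
  exact lt_of_le_of_lt (upperEnvelope_le (hy.mono fun z hz => hz.le)) hrs

theorem upperEnvelope_comp_homeomorph {Y : Type*} [TopologicalSpace Y] (u : Y → ℝ) (σ : X ≃ₜ Y)
    (x : X) : upperEnvelope (fun x => u (σ x)) x = upperEnvelope u (σ x) := by
  unfold upperEnvelope
  rw [← σ.map_nhds_eq]
  rfl

/-- Local upper bounds can be pushed forward and pulled back through increasing fibre maps that
depend continuously on the point. This transfers every symmetry of a family of graphs to the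
envelopes. -/
theorem LocallyBddAbove.upperEnvelope_map (hu : LocallyBddAbove u) {G : X → ℝ → ℝ}
    (hG : Continuous fun z : X × ℝ => G z.1 z.2) (hmono : ∀ x, StrictMono (G x)) (x : X) :
    upperEnvelope (fun x => G x (u x)) x = G x (upperEnvelope u x) := by
  have key : ∀ e, Continuous fun y => G y e := fun e => hG.comp (by fun_prop : Continuous fun y => (y, e))
  have key' : Continuous (G x) := hG.comp (by fun_prop : Continuous fun e => (x, e))
  have up : ∀ s, G x (upperEnvelope u x) < s → ∀ᶠ y in 𝓝 x, G y (u y) < s := by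
    intro s hs
    have h1 : ∀ᶠ e in 𝓝[>] (upperEnvelope u x), G x e < s :=
      (key'.continuousAt.eventually_lt_const hs).filter_mono nhdsWithin_le_nhds
    obtain ⟨e, he, hxe⟩ := (h1.and self_mem_nhdsWithin).exists
    filter_upwards [hu.eventually_lt hxe, (key e).continuousAt.eventually_lt_const he] with y h2 h3
    exact ((hmono y).monotone h2.le).trans_lt h3
  have hGu : LocallyBddAbove fun y => G y (u y) := by
    intro x
    obtain ⟨C, hC⟩ := hu x
    refine ⟨G x C + 1, ?_⟩
    filter_upwards [hC, (key C).continuousAt.eventually_lt_const (lt_add_one (G x C))] with y h2 h3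
    exact ((hmono y).monotone h2).trans h3.le
  refine le_antisymm (le_of_forall_gt_imp_ge_of_dense fun s hs =>
    upperEnvelope_le ((up s hs).mono fun y hy => hy.le)) ?_
  by_contra! hlt
  obtain ⟨s, hs, hs'⟩ := exists_between hlt
  have h1 : ∀ᶠ e in 𝓝[<] (upperEnvelope u x), s < G x e :=
    (key'.continuousAt.eventually_const_lt hs').filter_mono nhdsWithin_le_nhds
  obtain ⟨e, he, hxe⟩ := (h1.and self_mem_nhdsWithin).exists
  -- A bound `s` on `G y (u y)` near `x`, lying below `G y e`, forces `u y ≤ e` there, with `e`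
  -- strictly below the envelope of `u`.
  refine absurd (upperEnvelope_le ?_) (not_le.2 hxe)
  filter_upwards [hGu.eventually_lt hs, (key e).continuousAt.eventually_const_lt he] with y h2 h3
  exact ((hmono y).lt_iff_lt.1 (h2.trans h3)).le

theorem isOpen_setOf_upperEnvelope_lt (hu : LocallyBddAbove u) (hv : LowerSemicontinuous v) :
    IsOpen {x | upperEnvelope u x < v x} := by
  rw [isOpen_iff_eventually]
  intro x hx
  obtain ⟨c, h1, h2⟩ := exists_between (show upperEnvelope u x < v x from hx)
  filter_upwards [hu.eventually_upperEnvelope_lt h1, hv x c h2] with y h3 h4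
  exact h3.trans h4

/-- The opposite strict inequality is an open condition, so it cannot hold anywhere if it fails on a
dense set. -/
theorem le_upperEnvelope_of_dense (hu : LocallyBddAbove u) (hv : LowerSemicontinuous v)
    (h : Dense {x | v x ≤ upperEnvelope u x}) (x : X) : v x ≤ upperEnvelope u x := by
  by_contra! hx
  obtain ⟨y, hy, hy'⟩ := h.inter_open_nonempty _ (isOpen_setOf_upperEnvelope_lt hu hv) ⟨x, hx⟩
  exact absurd (show v y ≤ upperEnvelope u y from hy') (not_le.2 hy)

/-- In a small open set take a point where `u` comes within `ε` of its supremum over that set; this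
supremum bounds the envelope there. -/
theorem dense_setOf_upperEnvelope_lt_add (hu : LocallyBddAbove u) {ε : ℝ} (hε : 0 < ε) :
    Dense {x | upperEnvelope u x < u x + ε} := by
  rw [dense_iff_inter_open]
  rintro O hO ⟨x, hx⟩
  obtain ⟨C, hC⟩ := hu x
  obtain ⟨O', hO', hO'o, hxO'⟩ := eventually_nhds_iff.1 (hC.and (hO.mem_nhds hx))
  have hne : (u '' O').Nonempty := ⟨_, x, hxO', rfl⟩
  have hbdd : BddAbove (u '' O') := ⟨C, by rintro _ ⟨y, hy, rfl⟩; exact (hO' y hy).1⟩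
  obtain ⟨_, ⟨y, hy, rfl⟩, hlt⟩ := exists_lt_of_lt_csSup hne (sub_lt_self (sSup (u '' O')) hε)
  refine ⟨y, (hO' y hy).2, ?_⟩
  have : upperEnvelope u y ≤ sSup (u '' O') :=
    upperEnvelope_le (by
      filter_upwards [hO'o.mem_nhds hy] with z hz
      exact le_csSup hbdd ⟨z, hz, rfl⟩)
  change upperEnvelope u y < u y + ε
  linarith

/-- A chain of lower semicontinuous functions, each one below the upper envelope of the previous
one, cannot gain height. -/
theorem exists_lt_of_chain [Nonempty X] {u : ℕ → X → ℝ} (hu : ∀ k, LocallyBddAbove (u k))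
    (hl : ∀ k, LowerSemicontinuous (u k)) {K : ℕ}
    (h : ∀ k < K, ∀ x, u (k + 1) x ≤ upperEnvelope (u k) x) {η : ℝ} (hη : 0 < η) :
    ∃ x, u K x < u 0 x + η := by
  -- Dividing by `K + 1` keeps `K * ε` strictly below `η` and allows `K = 0`.
  set ε : ℝ := η / (K + 1) with hεdef
  have hε : 0 < ε := by positivity
  -- Each step loses at most `ε` on a dense set which is also open, by lower semicontinuity of `u
  -- k`; hence a nonempty open set survives every intersection.
  have main : ∀ k ≤ K, ∃ O : Set X, IsOpen O ∧ O.Nonempty ∧ ∀ x ∈ O, u k x ≤ u 0 x + k * ε := by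
    intro k
    induction k with
    | zero => exact fun _ => ⟨univ, isOpen_univ, univ_nonempty, by simp⟩
    | succ k ih =>
      intro hk
      obtain ⟨O, hO, hne, hOu⟩ := ih (by omega)
      have hopen : IsOpen {x | upperEnvelope (u k) x < u k x + ε} :=
        isOpen_setOf_upperEnvelope_lt (hu k)
          (by simpa using (hl k).add (lowerSemicontinuous_const (z := ε)))
      refine ⟨_, hO.inter hopen,
        (dense_setOf_upperEnvelope_lt_add (hu k) hε).inter_open_nonempty O hO hne, ?_⟩
      rintro x ⟨hx, hx'⟩
      have h1 := hOu x hx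
      have h2 := h k (by omega) x
      have h3 : upperEnvelope (u k) x < u k x + ε := hx'
      push_cast
      linarith
  obtain ⟨O, -, ⟨x, hx⟩, hO⟩ := main K le_rfl
  refine ⟨x, (hO x hx).trans_lt ?_⟩
  have : (K : ℝ) * ε < η := by
    rw [hεdef, mul_div_assoc', div_lt_iff₀ (by positivity)]
    linarith
  linarith

end Envelope

/-! ### Kronecker's theorem. -/

section Kronecker

/-- Kronecker's theorem: an element of the torus not annihilated by any nontrivial character
generates a dense subgroup. -/
theorem dense_zmultiples_unitAddTorus {d : Type*} [Fintype d] {g : UnitAddTorus d}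
    (hg : ∀ n : d → ℤ, UnitAddTorus.mFourier n g = 1 → n = 0) :
    Dense (AddSubgroup.zmultiples g : Set (UnitAddTorus d)) := by
  set G : Set (UnitAddTorus d) := (AddSubgroup.zmultiples g : Set (UnitAddTorus d)) with hG
  -- The distance to the subgroup is invariant under translation by `g`, so all its nonconstant
  -- Fourier coefficients vanish. It is therefore constant, and it is zero at the origin.
  let f : C(UnitAddTorus d, ℂ) := ⟨fun x => (Metric.infDist x G : ℂ), by
    have := Metric.continuous_infDist_pt G; fun_prop⟩
  have hinv : ∀ x, f (x + g) = f x := by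
    intro x
    change ((Metric.infDist (x + g) G : ℝ) : ℂ) = ((Metric.infDist x G : ℝ) : ℂ)
    have him : (fun y => y + g) '' G = G := by
      ext y
      simp only [hG, Set.mem_image, SetLike.mem_coe]
      constructor
      · rintro ⟨z, hz, rfl⟩
        exact add_mem hz (AddSubgroup.mem_zmultiples g)
      · exact fun hy => ⟨y - g, sub_mem hy (AddSubgroup.mem_zmultiples g), by simp⟩
    have := Metric.infDist_image (isometry_add_right g) (x := x) (t := G)
    rw [him] at this
    rw [this]
  have hcoef : ∀ n : d → ℤ, n ≠ 0 → UnitAddTorus.mFourierCoeff f n = 0 := by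
    intro n hn
    have h1 : UnitAddTorus.mFourierCoeff f n
        = UnitAddTorus.mFourier (-n) g * UnitAddTorus.mFourierCoeff f n := by
      let _ : MeasureTheory.MeasureSpace UnitAddCircle := ⟨AddCircle.haarAddCircle⟩
      have : (MeasureTheory.volume : MeasureTheory.Measure UnitAddCircle).IsAddHaarMeasure :=
        inferInstanceAs AddCircle.haarAddCircle.IsAddHaarMeasure
      have : MeasureTheory.SigmaFinite
          (MeasureTheory.volume : MeasureTheory.Measure UnitAddCircle) :=
        inferInstanceAs (MeasureTheory.SigmaFinite AddCircle.haarAddCircle)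
      have : (MeasureTheory.volume : MeasureTheory.Measure (UnitAddTorus d)).IsAddRightInvariant :=
        inferInstanceAs (MeasureTheory.Measure.pi fun _ : d =>
          (MeasureTheory.volume : MeasureTheory.Measure UnitAddCircle)).IsAddRightInvariant
      unfold UnitAddTorus.mFourierCoeff
      conv_lhs => rw [← MeasureTheory.integral_add_right_eq_self _ g]
      rw [← MeasureTheory.integral_const_mul]
      congr 1
      ext x
      rw [hinv]
      have : UnitAddTorus.mFourier (-n) (x + g)
          = UnitAddTorus.mFourier (-n) x * UnitAddTorus.mFourier (-n) g := by
        simp [UnitAddTorus.mFourier, ← Finset.prod_mul_distrib, fourier_apply, smul_add,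
          AddCircle.toCircle_add]
      rw [this, smul_eq_mul, smul_eq_mul]
      ring
    by_contra hne
    have h2 : UnitAddTorus.mFourier (-n) g = 1 := by
      have : (UnitAddTorus.mFourier (-n) g - 1) * UnitAddTorus.mFourierCoeff f n = 0 := by
        rw [sub_mul, ← h1, one_mul, sub_self]
      rcases mul_eq_zero.1 this with h | h
      · exact sub_eq_zero.1 h
      · exact absurd h hne
    exact hn (neg_eq_zero.1 (hg _ h2))
  have hsum : Summable (UnitAddTorus.mFourierCoeff f) :=
    summable_of_ne_finset_zero (s := {0}) fun n hn => hcoef n (by simpa using hn)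
  have hconst : ∀ x, f x = UnitAddTorus.mFourierCoeff f 0 := by
    intro x
    have h1 := UnitAddTorus.hasSum_mFourier_series_apply_of_summable hsum x
    have h2 := hasSum_single (f := fun i =>
      UnitAddTorus.mFourierCoeff f i • UnitAddTorus.mFourier i x) 0 (fun n hn => by simp [hcoef n hn])
    rw [h1.unique h2]
    simp [UnitAddTorus.mFourier_zero]
  intro x
  have hne : G.Nonempty := ⟨0, zero_mem _⟩
  rw [Metric.mem_closure_iff_infDist_zero hne]
  have h1 : f x = f 0 := by rw [hconst, hconst]
  have h2 : Metric.infDist (0 : UnitAddTorus d) G = 0 :=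
    Metric.infDist_zero_of_mem (zero_mem (AddSubgroup.zmultiples g))
  have h3 : ((Metric.infDist x G : ℝ) : ℂ) = ((Metric.infDist 0 G : ℝ) : ℂ) := h1
  rw [h2] at h3
  exact_mod_cast h3

/-- Orbits of an irrational translation of `Circ × ℝ`, modulo vertical integer translations,
are dense. -/
theorem exists_translate_mem {ω ρ : ℝ}
    (h : ∀ l k q : ℤ, (l : ℝ) + k * ω + q * ρ = 0 → k = 0 ∧ q = 0) (z : Circ × ℝ)
    {O : Set (Circ × ℝ)} (hO : IsOpen O) (hne : O.Nonempty) :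
    ∃ n m : ℤ, (z.1 + ((n * ω : ℝ) : Circ), z.2 + n * ρ + m) ∈ O := by
  let g : UnitAddTorus (Fin 2) := ![(ω : Circ), (ρ : Circ)]
  have hd : Dense (AddSubgroup.zmultiples g : Set (UnitAddTorus (Fin 2))) := by
    apply dense_zmultiples_unitAddTorus
    intro n hn
    have h1 : AddCircle.toCircle (((n 0 * ω + n 1 * ρ : ℝ)) : Circ) = 1 := by
      refine Circle.coe_injective ?_
      rw [Circle.coe_one, ← hn]
      simp [UnitAddTorus.mFourier, g, fourier_apply, AddCircle.toCircle_add]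
    have h2 : (((n 0 * ω + n 1 * ρ : ℝ)) : Circ) = 0 := by
      apply AddCircle.injective_toCircle one_ne_zero
      rw [h1, AddCircle.toCircle_zero]
    obtain ⟨m, hm⟩ := (AddCircle.coe_eq_zero_iff (1 : ℝ)).1 h2
    have h3 := h (-m) (n 0) (n 1) (by simp at hm; push_cast; linarith)
    ext i
    fin_cases i
    · exact h3.1
    · exact h3.2
  let e : UnitAddTorus (Fin 2) → Torus := fun x => (z.1 + x 0, (z.2 : Circ) + x 1)
  have he : Continuous e := by fun_prop
  obtain ⟨w, hw⟩ := hne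
  obtain ⟨x, hx, hxG⟩ := hd.inter_open_nonempty (e ⁻¹' (proj '' O)) ((isOpenMap_proj O hO).preimage he)
    ⟨![w.1 - z.1, (w.2 : Circ) - (z.2 : Circ)], w, hw, by simp [e, proj]⟩
  obtain ⟨n, rfl⟩ := hxG
  obtain ⟨v, hv, hve⟩ := hx
  have h1 : v.1 = z.1 + n • (ω : Circ) := congrArg Prod.fst hve
  have h2 : (v.2 : Circ) = (z.2 : Circ) + n • (ρ : Circ) := congrArg Prod.snd hve
  have h3 : (v.2 : Circ) = ((z.2 + n * ρ : ℝ) : Circ) := by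
    rw [h2]; simp
  obtain ⟨m, hm⟩ := coe_eq_coe_iff.1 h3
  refine ⟨n, m, ?_⟩
  convert hv using 1
  refine Prod.ext ?_ hm.symm
  rw [h1]
  simp

end Kronecker

/-! ### Lifts as fibred homeomorphisms of `Circ × ℝ`. -/

/-- A homeomorphism of `Circ × ℝ` over the rotation by `α` whose fibre maps are increasing and
commute with the unit translation. -/
structure IsFibredShift (α : Circ) (Φ : (Circ × ℝ) ≃ₜ (Circ × ℝ)) : Prop where
  fst_apply : ∀ z, (Φ z).1 = z.1 + α
  strictMono : ∀ θ, StrictMono fun x => (Φ (θ, x)).2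
  add_one : ∀ θ x, (Φ (θ, x + 1)).2 = (Φ (θ, x)).2 + 1

namespace IsFibredShift

variable {α β : Circ} {Φ Ψ : (Circ × ℝ) ≃ₜ (Circ × ℝ)}

theorem apply_eq (h : IsFibredShift α Φ) (z : Circ × ℝ) : Φ z = (z.1 + α, (Φ z).2) :=
  Prod.ext (h.fst_apply z) rfl

theorem one : IsFibredShift 0 (1 : (Circ × ℝ) ≃ₜ (Circ × ℝ)) :=
  ⟨fun z => by simp, fun θ x y hxy => by simpa using hxy, fun θ x => rfl⟩

theorem mul (h : IsFibredShift α Φ) (h' : IsFibredShift β Ψ) : IsFibredShift (α + β) (Φ * Ψ) where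
  fst_apply z := by
    rw [Homeomorph.mul_apply, h.fst_apply, h'.fst_apply, add_assoc, add_comm β]
  strictMono θ x y hxy := by
    simp only [Homeomorph.mul_apply]
    rw [h'.apply_eq (θ, x), h'.apply_eq (θ, y)]
    exact h.strictMono _ (h'.strictMono θ hxy)
  add_one θ x := by
    simp only [Homeomorph.mul_apply]
    rw [h'.apply_eq (θ, x), h'.apply_eq (θ, x + 1), h'.add_one]
    exact h.add_one _ _

theorem inv (h : IsFibredShift α Φ) : IsFibredShift (-α) Φ⁻¹ := by
  have hfst : ∀ z, (Φ⁻¹ z).1 = z.1 + -α := by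
    intro z
    have := h.fst_apply (Φ⁻¹ z)
    rw [Homeomorph.inv_apply, Homeomorph.apply_symm_apply] at this
    rw [Homeomorph.inv_apply, this]
    abel
  have happ : ∀ θ x, Φ (θ + -α, (Φ⁻¹ (θ, x)).2) = (θ, x) := by
    intro θ x
    have : ((θ + -α, (Φ⁻¹ (θ, x)).2) : Circ × ℝ) = Φ⁻¹ (θ, x) := Prod.ext (hfst (θ, x)).symm rfl
    rw [this, Homeomorph.inv_apply, Homeomorph.apply_symm_apply]
  refine ⟨hfst, fun θ x y hxy => ?_, fun θ x => ?_⟩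
  · refine (h.strictMono (θ + -α)).lt_iff_lt.1 ?_
    simp only [happ]
    exact hxy
  · refine (h.strictMono (θ + -α)).injective ?_
    simp only [happ, h.add_one]

theorem zpow (h : IsFibredShift α Φ) (n : ℤ) : IsFibredShift (n • α) (Φ ^ n) := by
  induction n with
  | zero => simpa using one
  | succ n ih => rw [zpow_add_one, add_zsmul, one_zsmul]; exact ih.mul h
  | pred n ih => rw [zpow_sub_one, sub_zsmul, one_zsmul]; exact ih.mul h.inv

theorem add_intCast (h : IsFibredShift α Φ) (θ : Circ) (x : ℝ) (m : ℤ) :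
    (Φ (θ, x + m)).2 = (Φ (θ, x)).2 + m := by
  let g : CircleDeg1Lift := ⟨⟨fun x => (Φ (θ, x)).2, (h.strictMono θ).monotone⟩, h.add_one θ⟩
  exact g.map_add_int x m

end IsFibredShift

/-- A lift of a regular forced circle homeomorphism with rotation number `ρ`. -/
structure RegularLift (ω ρ : ℝ) where
  /-- the homeomorphism of `Circ × ℝ` -/
  Φ : (Circ × ℝ) ≃ₜ (Circ × ℝ)
  isFibredShift : IsFibredShift (ω : Circ) Φ
  irrational : Irrational ω
  bounded : ∃ C : ℝ, ∀ (n : ℤ) z, |((Φ ^ n) z).2 - z.2 - n * ρ| ≤ C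

section Lifts

variable {T : ForcedCircleHomeo} {F : C(Circ × ℝ, Circ × ℝ)}

theorem IsLift.fst_apply (hF : IsLift T.toMap F) (z : Circ × ℝ) : (F z).1 = z.1 + (T.ω : Circ) :=
  (congrArg Prod.fst (hF z)).trans (T.map_fst (proj z))

/-- The fibre maps of a lift are increasing, surjective and commute with the unit translation. -/
theorem IsLift.fibre (hF : IsLift T.toMap F) (θ : Circ) :
    StrictMono (fun x => (F (θ, x)).2) ∧ Function.Surjective (fun x => (F (θ, x)).2) ∧
      ∀ x, (F (θ, x + 1)).2 = (F (θ, x)).2 + 1 := by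
  obtain ⟨hf, g, hg⟩ := T.fibre_map θ
  have hinj : Function.Injective g := by
    intro x y hxy
    have h1 : (x : Circ) = (y : Circ) := hf.injective (by simp only [hg, hxy])
    obtain ⟨m, rfl⟩ := coe_eq_coe_iff.1 h1
    rw [g.map_add_int, add_eq_left] at hxy
    rw [hxy, add_zero]
  have hsurj : Function.Surjective g := by
    intro y
    obtain ⟨c, hc⟩ := hf.surjective (y : Circ)
    obtain ⟨x, rfl⟩ := QuotientAddGroup.mk_surjective c
    obtain ⟨m, hm⟩ := coe_eq_coe_iff.1 ((hg x).symm.trans hc)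
    exact ⟨x + (-m : ℤ), by rw [g.map_add_int, hm]; push_cast; ring⟩
  have hcont : Continuous g := g.monotone.continuous_of_surjective hsurj
  have hcoe : ∀ x : ℝ, ((F (θ, x)).2 : Circ) = ((g x : ℝ) : Circ) := fun x =>
    (congrArg Prod.snd (hF (θ, x))).trans (hg x)
  obtain ⟨m, hm⟩ := coe_eq_coe_iff.1 (hcoe 0)
  -- Both sides are continuous lifts of the same circle map and agree at `0`.
  have heq : (fun x => (F (θ, x)).2) = fun x => g x + m := by
    refine (AddCircle.isCoveringMap_coe (1 : ℝ)).eq_of_comp_eq (by fun_prop) (by fun_prop) ?_ 0 hm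
    ext x
    exact (hcoe x).trans (coe_add_intCast _ _).symm
  have heq' : ∀ x, (F (θ, x)).2 = g x + m := congrFun heq
  refine ⟨?_, ?_, fun x => by rw [heq', heq', g.map_add_one]; ring⟩
  · rw [heq]
    exact (g.strictMono_iff_injective.2 hinj).add_const _
  · intro y
    obtain ⟨x, hx⟩ := hsurj (y - m)
    exact ⟨x, by simp [heq', hx]⟩

theorem IsLift.bijective (hF : IsLift T.toMap F) : Function.Bijective F := by
  constructor
  · rintro ⟨θ, x⟩ ⟨η, y⟩ h
    have h1 : θ = η := by
      have := congrArg Prod.fst h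
      rw [hF.fst_apply, hF.fst_apply] at this
      exact add_right_cancel this
    subst h1
    rw [(hF.fibre θ).1.injective (congrArg Prod.snd h)]
  · rintro ⟨θ, y⟩
    obtain ⟨x, hx⟩ := (hF.fibre (θ - (T.ω : Circ))).2.1 y
    exact ⟨(θ - (T.ω : Circ), x), Prod.ext (by rw [hF.fst_apply]; simp) hx⟩

/-- A lift as a homeomorphism. -/
def IsLift.homeomorph (hF : IsLift T.toMap F) : (Circ × ℝ) ≃ₜ (Circ × ℝ) where
  toEquiv := Equiv.ofBijective F hF.bijective
  continuous_toFun := F.continuous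
  continuous_invFun := by
    set e := Equiv.ofBijective F hF.bijective with he
    have hfst : ∀ z, (e.symm z).1 = z.1 - (T.ω : Circ) := by
      intro z
      have := hF.fst_apply (e.symm z)
      rw [show F (e.symm z) = z from e.apply_symm_apply z] at this
      rw [this]; abel
    have happ : ∀ z, (F (z.1 - (T.ω : Circ), (e.symm z).2)).2 = z.2 := by
      intro z
      rw [← hfst]
      exact congrArg Prod.snd (e.apply_symm_apply z)
    change Continuous fun z => ((e.symm z).1, (e.symm z).2)
    refine Continuous.prodMk (by simp only [hfst]; fun_prop) ?_
    -- By fibrewise monotonicity, comparing the inverse image with a constant `s` amounts to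
    -- comparing `w.2` with the image of `s`, which depends continuously on the base point.
    refine continuous_iff_lower_upperSemicontinuous.2 ⟨fun z s hs => ?_, fun z s hs => ?_⟩
    · have hopen : IsOpen {w : Circ × ℝ | (F (w.1 - (T.ω : Circ), s)).2 < w.2} :=
        isOpen_lt (by fun_prop) (by fun_prop)
      have hmem : ∀ w : Circ × ℝ, (F (w.1 - (T.ω : Circ), s)).2 < w.2 ↔ s < (e.symm w).2 := by
        intro w
        conv_lhs => rw [← happ w]
        exact (hF.fibre _).1.lt_iff_lt
      filter_upwards [hopen.mem_nhds ((hmem z).2 hs)] with w hw using (hmem w).1 hw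
    · have hopen : IsOpen {w : Circ × ℝ | w.2 < (F (w.1 - (T.ω : Circ), s)).2} :=
        isOpen_lt (by fun_prop) (by fun_prop)
      have hmem : ∀ w : Circ × ℝ, w.2 < (F (w.1 - (T.ω : Circ), s)).2 ↔ (e.symm w).2 < s := by
        intro w
        conv_lhs => rw [← happ w]
        exact (hF.fibre _).1.lt_iff_lt
      filter_upwards [hopen.mem_nhds ((hmem z).2 hs)] with w hw using (hmem w).1 hw

theorem IsLift.isFibredShift (hF : IsLift T.toMap F) :
    IsFibredShift (T.ω : Circ) hF.homeomorph :=
  ⟨hF.fst_apply, fun θ => (hF.fibre θ).1, fun θ => (hF.fibre θ).2.2⟩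

end Lifts

/-! ### Uniform bounds for full orbits. -/

section Bounded

variable {ω ρ : ℝ} {Φ : (Circ × ℝ) ≃ₜ (Circ × ℝ)}

/-- The displacement is `1`-periodic in the fibre, and monotonicity limits its variation over one
period. -/
theorem IsFibredShift.abs_sub_sub_le {α : Circ} (h : IsFibredShift α Φ) (θ : Circ) (x : ℝ) :
    |((Φ (θ, x)).2 - x) - (Φ (θ, 0)).2| ≤ 1 := by
  have h1 := h.add_intCast θ (Int.fract x) ⌊x⌋
  rw [Int.fract_add_floor] at h1
  have h2 : (Φ (θ, 0)).2 ≤ (Φ (θ, Int.fract x)).2 :=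
    (h.strictMono θ).monotone (Int.fract_nonneg x)
  have h3 : (Φ (θ, Int.fract x)).2 ≤ (Φ (θ, 0)).2 + 1 := by
    rw [← h.add_one, zero_add]
    exact (h.strictMono θ).monotone (Int.fract_lt_one x).le
  have h4 := Int.fract_add_floor x
  have h5 := Int.fract_nonneg x
  have h6 := Int.fract_lt_one x
  rw [abs_le]
  constructor <;> linarith

theorem dense_nsmul_coe (hω : Irrational ω) : DenseRange fun n : ℕ => n • (ω : Circ) :=
  denseRange_zsmul_iff_nsmul.1 (AddCircle.denseRange_zsmul_coe_iff.2 (by simpa using hω))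

/-- If all forward orbits are `ρ`-bounded, then all full orbits are so, with a common constant. -/
theorem IsFibredShift.exists_bound (h : IsFibredShift (ω : Circ) Φ) (hω : Irrational ω)
    (hb : ∀ θ, ∃ C : ℝ, ∀ n : ℕ, |((Φ ^ n) (θ, 0)).2 - n * ρ| ≤ C) :
    ∃ C : ℝ, ∀ (n : ℤ) z, |((Φ ^ n) z).2 - z.2 - n * ρ| ≤ C := by
  have hpow : ∀ n : ℕ, IsFibredShift (n • (ω : Circ)) (Φ ^ n) := fun n => by
    simpa using h.zpow n
  -- Baire: closed sets indexed by the bound exhaust the circle, so one of them has interior.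
  obtain ⟨K, hK⟩ : ∃ K : ℕ,
      (interior {θ : Circ | ∀ n : ℕ, |((Φ ^ n) (θ, 0)).2 - n * ρ| ≤ K}).Nonempty := by
    apply nonempty_interior_of_iUnion_of_closed
    · intro K
      simp only [ofPred_forall]
      exact isClosed_iInter fun n => isClosed_le (by fun_prop) continuous_const
    · refine eq_univ_of_forall fun θ => mem_iUnion.2 ?_
      obtain ⟨C, hC⟩ := hb θ
      obtain ⟨K, hK⟩ := exists_nat_ge C
      exact ⟨K, fun n => (hC n).trans hK⟩
  have h1 : ∀ z : Circ × ℝ, z.1 ∈ {θ : Circ | ∀ n : ℕ, |((Φ ^ n) (θ, 0)).2 - n * ρ| ≤ K} →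
      ∀ n : ℕ, |((Φ ^ n) z).2 - z.2 - n * ρ| ≤ K + 1 := by
    intro z hz n
    have h2 := hz n
    have h3 := (hpow n).abs_sub_sub_le z.1 z.2
    rw [abs_le] at *
    constructor <;> linarith
  have h2 : ∀ (n : ℕ) z, |((Φ ^ n) z).2 - z.2 - n * ρ| ≤ 2 * (K + 1) := by
    intro n z
    -- Some backward iterate `w` of `z` lies over that interior. The orbit segment of `z` is the
    -- difference of two segments starting at `w`, which doubles the constant.
    obtain ⟨j, hj⟩ := (dense_nsmul_coe hω).exists_mem_open
      (isOpen_interior.preimage (by fun_prop : Continuous fun c : Circ => z.1 - c))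
      (by obtain ⟨c, hc⟩ := hK; exact ⟨z.1 - c, by simpa using hc⟩)
    set w := (Φ ^ j).symm z with hw
    have hzw : (Φ ^ j) w = z := Homeomorph.apply_symm_apply _ _
    have hw1 : w.1 = z.1 - j • (ω : Circ) := by
      rw [← hzw, (hpow j).fst_apply]; simp
    have hwK := interior_subset hj
    change z.1 - j • (ω : Circ) ∈ _ at hwK
    rw [← hw1] at hwK
    have h3 := h1 w hwK (n + j)
    have h4 := h1 w hwK j
    rw [pow_add, Homeomorph.mul_apply, hzw] at h3
    rw [hzw] at h4
    push_cast at h3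
    rw [abs_le] at *
    constructor <;> linarith
  refine ⟨2 * (K + 1), fun n z => ?_⟩
  obtain ⟨n, rfl | rfl⟩ := n.eq_nat_or_neg
  · simpa using h2 n z
  · have h3 := h2 n ((Φ ^ (-(n : ℤ))) z)
    have h4 : (Φ ^ n) ((Φ ^ (-(n : ℤ))) z) = z := by
      rw [← Homeomorph.mul_apply, zpow_neg, zpow_natCast, mul_inv_cancel, Homeomorph.one_apply]
    rw [h4] at h3
    push_cast
    rw [abs_le] at *
    constructor <;> linarith

end Bounded

theorem ForcedCircleHomeo.isLift_someLift (T : ForcedCircleHomeo) :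
    IsLift T.toMap T.someLift :=
  T.exists_isLift.choose_spec

theorem ForcedCircleHomeo.IsRegular.exists_regularLift {T : ForcedCircleHomeo} (hT : T.IsRegular) :
    ∃ L : RegularLift T.ω (liftRotationNumber T.someLift),
      ∀ z, proj (L.Φ z) = T.toMap (proj z) := by
  have hF := T.isLift_someLift
  have hit : ∀ (n : ℕ) z, (hF.homeomorph ^ n) z = T.someLift^[n] z := by
    intro n
    induction n with
    | zero => intro z; rfl
    | succ n ih =>
      intro z
      rw [pow_succ, Homeomorph.mul_apply, ih, Function.iterate_succ_apply]
      rfl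
  refine ⟨⟨hF.homeomorph, hF.isFibredShift, T.irrational_ω,
    hF.isFibredShift.exists_bound T.irrational_ω fun θ => ?_⟩, hF⟩
  obtain ⟨C, hC⟩ := hT _ hF (θ, 0)
  exact ⟨C, fun n => by simpa [hit] using hC n⟩

/-! ### The equivariant family of graphs. -/

namespace RegularLift

variable {ω ρ : ℝ} (L : RegularLift ω ρ)

/-- The supremum of the images of `(θ - n ω, y - n ρ)` under the `n`-th iterates. -/
def supGraph (z : Circ × ℝ) : ℝ :=
  ⨆ n : ℤ, ((L.Φ ^ n) (z.1 - n • (ω : Circ), z.2 - n * ρ)).2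

theorem abs_sub_le : ∃ C : ℝ, ∀ (n : ℤ) (z : Circ × ℝ),
    |((L.Φ ^ n) (z.1 - n • (ω : Circ), z.2 - n * ρ)).2 - z.2| ≤ C := by
  obtain ⟨C, hC⟩ := L.bounded
  refine ⟨C, fun n z => ?_⟩
  have := hC n (z.1 - n • (ω : Circ), z.2 - n * ρ)
  rwa [show ∀ a b c : ℝ, a - (b - c) - c = a - b by intros; ring] at this

theorem bddAbove (z : Circ × ℝ) :
    BddAbove (range fun n : ℤ => ((L.Φ ^ n) (z.1 - n • (ω : Circ), z.2 - n * ρ)).2) := by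
  obtain ⟨C, hC⟩ := L.abs_sub_le
  refine ⟨z.2 + C, ?_⟩
  rintro _ ⟨n, rfl⟩
  have := (abs_le.1 (hC n z)).2
  change ((L.Φ ^ n) (z.1 - n • (ω : Circ), z.2 - n * ρ)).2 ≤ z.2 + C
  linarith

theorem exists_abs_supGraph_sub_le : ∃ C : ℝ, ∀ z, |L.supGraph z - z.2| ≤ C := by
  obtain ⟨C, hC⟩ := L.abs_sub_le
  refine ⟨C, fun z => abs_le.2 ⟨?_, ?_⟩⟩
  · have h1 := (abs_le.1 (hC 0 z)).1
    have h2 := le_ciSup (L.bddAbove z) 0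
    change _ ≤ L.supGraph z at h2
    linarith
  · rw [sub_le_iff_le_add]
    refine ciSup_le fun n => ?_
    have := (abs_le.1 (hC n z)).2
    linarith

theorem locallyBddAbove_supGraph_comp {X : Type*} [TopologicalSpace X] {f : X → Circ × ℝ}
    (hf : Continuous f) : LocallyBddAbove fun x => L.supGraph (f x) := by
  obtain ⟨C, hC⟩ := L.exists_abs_supGraph_sub_le
  refine fun x => ⟨(f x).2 + 1 + C, ?_⟩
  filter_upwards [(continuous_snd.comp hf).continuousAt.eventually_lt_const
    (lt_add_one (f x).2)] with y hy
  have := (abs_le.1 (hC (f y))).2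
  change (f y).2 < (f x).2 + 1 at hy
  linarith

theorem locallyBddAbove_supGraph : LocallyBddAbove L.supGraph :=
  L.locallyBddAbove_supGraph_comp continuous_id

theorem lowerSemicontinuous_supGraph : LowerSemicontinuous L.supGraph :=
  lowerSemicontinuous_ciSup L.bddAbove fun n => Continuous.lowerSemicontinuous (by fun_prop)

theorem supGraph_mono (θ : Circ) : Monotone fun y => L.supGraph (θ, y) := fun _ _ hxy =>
  ciSup_mono (L.bddAbove _) fun n =>
    ((L.isFibredShift.zpow n).strictMono _).monotone (sub_le_sub_right hxy _)

theorem supGraph_add_intCast (θ : Circ) (y : ℝ) (m : ℤ) :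
    L.supGraph (θ, y + m) = L.supGraph (θ, y) + m := by
  unfold supGraph
  rw [ciSup_add (L.bddAbove _)]
  congr 1
  ext n
  rw [← (L.isFibredShift.zpow n).add_intCast]
  congr 3
  simp only
  ring

/-- A continuous increasing fibre map commutes with the supremum and sends the `n`-th term to the
`(n + 1)`-st. Since `n` ranges over all of `ℤ`, this only reindexes the family. -/
theorem supGraph_translate (θ : Circ) (y : ℝ) :
    L.supGraph (θ + (ω : Circ), y + ρ) = (L.Φ (θ, L.supGraph (θ, y))).2 := by
  have hmono := (L.isFibredShift.strictMono θ).monotone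
  have hcont : Continuous fun x => (L.Φ (θ, x)).2 := by fun_prop
  have h1 := hmono.map_ciSup_of_continuousAt hcont.continuousAt (L.bddAbove (θ, y))
  refine Eq.trans ?_ h1.symm
  unfold supGraph
  refine ((Equiv.addRight (1 : ℤ)).iSup_congr fun n => ?_).symm
  have h2 : ((θ, ((L.Φ ^ n) (θ - n • (ω : Circ), y - n * ρ)).2) : Circ × ℝ)
      = (L.Φ ^ n) (θ - n • (ω : Circ), y - n * ρ) := by
    refine Prod.ext ?_ rfl
    rw [(L.isFibredShift.zpow n).fst_apply]
    simp
  simp only [h2, Equiv.coe_addRight]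
  rw [add_comm n 1, zpow_add, zpow_one, Homeomorph.mul_apply, add_zsmul, one_zsmul]
  congr 4
  · abel
  · push_cast; ring

end RegularLift

/-! ### Strict separation in the independent case. -/

namespace RegularLift

variable {ω ρ : ℝ} (L : RegularLift ω ρ)

theorem upperEnvelope_supGraph_add (c : Circ) (s : ℝ) (z : Circ × ℝ) :
    upperEnvelope (fun z => L.supGraph (z.1 + c, z.2 + s)) z
      = upperEnvelope L.supGraph (z.1 + c, z.2 + s) :=
  upperEnvelope_comp_homeomorph L.supGraph
    ((Homeomorph.addRight c).prodCongr (Homeomorph.addRight s)) z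

theorem upperEnvelope_supGraph_translate (z : Circ × ℝ) :
    upperEnvelope L.supGraph (z.1 + (ω : Circ), z.2 + ρ)
      = (L.Φ (z.1, upperEnvelope L.supGraph z)).2 := by
  rw [← L.upperEnvelope_supGraph_add]
  simp only [supGraph_translate]
  exact L.locallyBddAbove_supGraph.upperEnvelope_map (G := fun z x => (L.Φ (z.1, x)).2)
    (by fun_prop) (fun z => L.isFibredShift.strictMono z.1) z

theorem upperEnvelope_supGraph_add_intCast (z : Circ × ℝ) (m : ℤ) :
    upperEnvelope L.supGraph (z.1, z.2 + m) = upperEnvelope L.supGraph z + m := by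
  have h := L.upperEnvelope_supGraph_add 0 m z
  simp only [add_zero, supGraph_add_intCast] at h
  rw [← h]
  exact L.locallyBddAbove_supGraph.upperEnvelope_map (G := fun _ x => x + m)
    (by fun_prop) (fun z => strictMono_id.add_const _) z

/-- Both sides of the contact relation are moved by the same increasing map, so contact is invariant
along orbits of the translation. -/
theorem supGraph_le_upperEnvelope_iff (δ : ℝ) (z : Circ × ℝ) (n m : ℤ) :
    L.supGraph (z.1 + ((n * ω : ℝ) : Circ), z.2 + n * ρ + m + δ)
        ≤ upperEnvelope L.supGraph (z.1 + ((n * ω : ℝ) : Circ), z.2 + n * ρ + m) ↔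
      L.supGraph (z.1, z.2 + δ) ≤ upperEnvelope L.supGraph z := by
  let P : Circ × ℝ → Prop := fun z => L.supGraph (z.1, z.2 + δ) ≤ upperEnvelope L.supGraph z
  have step : ∀ z : Circ × ℝ, P (z.1 + (ω : Circ), z.2 + ρ) ↔ P z := by
    intro z
    simp only [P]
    rw [L.upperEnvelope_supGraph_translate, add_right_comm, supGraph_translate]
    exact (L.isFibredShift.strictMono z.1).le_iff_le
  have hm : ∀ z : Circ × ℝ, P (z.1, z.2 + m) ↔ P z := by
    intro z
    simp only [P]
    rw [L.upperEnvelope_supGraph_add_intCast, add_right_comm, supGraph_add_intCast]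
    exact add_le_add_iff_right _
  have hn : ∀ n : ℤ, P (z.1 + ((n * ω : ℝ) : Circ), z.2 + n * ρ) ↔ P z := by
    intro n
    induction n with
    | zero => simp
    | succ n ih =>
      refine Iff.trans ?_ ((step _).trans ih)
      refine iff_of_eq (congrArg P (Prod.ext ?_ ?_))
      · simp [add_mul, add_assoc]
      · push_cast; ring
    | pred n ih =>
      refine Iff.trans ((step _).symm.trans (iff_of_eq (congrArg P (Prod.ext ?_ ?_)))) ih
      · simp [sub_mul]; abel
      · push_cast; ring
  exact (hm (z.1 + ((n * ω : ℝ) : Circ), z.2 + n * ρ)).trans (hn n)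

/-- One contact at offset `δ` spreads by Kronecker density to contact everywhere, which the chain
lemma excludes. -/
theorem upperEnvelope_supGraph_lt
    (hind : ∀ l k q : ℤ, (l : ℝ) + k * ω + q * ρ = 0 → k = 0 ∧ q = 0) (θ : Circ) {y y' : ℝ}
    (hy : y < y') : upperEnvelope L.supGraph (θ, y) < L.supGraph (θ, y') := by
  set δ := y' - y with hδ
  have hδ0 : 0 < δ := sub_pos.2 hy
  by_contra! hle
  have hlsc : ∀ s : ℝ, LowerSemicontinuous fun z : Circ × ℝ => L.supGraph (z.1, z.2 + s) :=
    fun s => L.lowerSemicontinuous_supGraph.comp (by fun_prop)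
  have hall : ∀ z : Circ × ℝ, L.supGraph (z.1, z.2 + δ) ≤ upperEnvelope L.supGraph z := by
    refine le_upperEnvelope_of_dense L.locallyBddAbove_supGraph (hlsc δ) ?_
    rw [dense_iff_inter_open]
    intro O hO hne
    obtain ⟨n, m, hnm⟩ := exists_translate_mem hind (θ, y) hO hne
    refine ⟨_, hnm, (L.supGraph_le_upperEnvelope_iff δ (θ, y) n m).2 ?_⟩
    rw [hδ]
    simpa using hle
  -- With `K * δ ≥ 1`, `K` steps raise the graph by at least `1` everywhere, whereas the chain gains
  -- less than `1` somewhere.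
  obtain ⟨K, hK⟩ := exists_nat_ge (1 / δ)
  obtain ⟨x, hx⟩ := exists_lt_of_chain (X := Circ × ℝ) (u := fun k z => L.supGraph (z.1, z.2 + k * δ))
    (fun k => L.locallyBddAbove_supGraph_comp (by fun_prop)) (fun k => hlsc _) (K := K)
    (fun k _ z => by
      have h1 := L.upperEnvelope_supGraph_add 0 (k * δ) z
      simp only [add_zero] at h1
      simp only [h1]
      have h2 := hall (z.1, z.2 + k * δ)
      refine le_trans (le_of_eq ?_) h2
      push_cast
      ring_nf) one_pos
  rw [div_le_iff₀ hδ0] at hK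
  have h1 : L.supGraph (x.1, x.2 + (1 : ℤ)) ≤ L.supGraph (x.1, x.2 + K * δ) :=
    L.supGraph_mono x.1 (by push_cast; linarith)
  rw [L.supGraph_add_intCast] at h1
  simp at hx
  push_cast at h1
  linarith

/-! ### The height function and the semi-conjugacy. -/

/-- The height of `z` in the family of invariant graphs `θ ↦ supGraph (θ, y)`. -/
def height (z : Circ × ℝ) : ℝ := sSup {y | L.supGraph (z.1, y) ≤ z.2}

theorem nonempty_height (z : Circ × ℝ) : {y | L.supGraph (z.1, y) ≤ z.2}.Nonempty := by
  obtain ⟨C, hC⟩ := L.exists_abs_supGraph_sub_le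
  refine ⟨z.2 - C, ?_⟩
  have := (abs_le.1 (hC (z.1, z.2 - C))).2
  change L.supGraph (z.1, z.2 - C) ≤ z.2
  linarith

theorem bddAbove_height (z : Circ × ℝ) : BddAbove {y | L.supGraph (z.1, y) ≤ z.2} := by
  obtain ⟨C, hC⟩ := L.exists_abs_supGraph_sub_le
  refine ⟨z.2 + C, fun y hy => ?_⟩
  have h1 := (abs_le.1 (hC (z.1, y))).1
  change L.supGraph (z.1, y) ≤ z.2 at hy
  simp only at h1
  linarith

theorem height_mono (θ : Circ) : Monotone fun x => L.height (θ, x) := fun x y hxy =>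
  csSup_le_csSup (L.bddAbove_height (θ, y)) (L.nonempty_height (θ, x)) fun _ hs => le_trans hs hxy

theorem height_eq_add {z w : Circ × ℝ} {c : ℝ}
    (h : ∀ y, L.supGraph (w.1, y + c) ≤ w.2 ↔ L.supGraph (z.1, y) ≤ z.2) :
    L.height w = L.height z + c := by
  unfold height
  have h1 := (OrderIso.addRight c).map_csSup' (L.nonempty_height z) (L.bddAbove_height z)
  refine Eq.trans ?_ h1.symm
  congr 1
  ext y
  simp only [OrderIso.addRight_apply, mem_image]
  constructor
  · intro hy
    exact ⟨y - c, (h (y - c)).1 (by simpa using hy), by simp⟩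
  · rintro ⟨x, hx, rfl⟩
    exact (h x).2 hx

theorem height_add_one (θ : Circ) (x : ℝ) : L.height (θ, x + 1) = L.height (θ, x) + 1 := by
  refine L.height_eq_add fun y => ?_
  have := L.supGraph_add_intCast θ y 1
  simp only [Int.cast_one] at this
  simp [this]

theorem height_apply (z : Circ × ℝ) : L.height (L.Φ z) = L.height z + ρ := by
  refine L.height_eq_add fun y => ?_
  rw [L.isFibredShift.fst_apply, supGraph_translate]
  exact (L.isFibredShift.strictMono z.1).le_iff_le

/-- Upper semicontinuity of the height follows from lower semicontinuity of `supGraph` alone. Strict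
separation serves the other half: if `r < y` and the graph at `y` is at most `z.2`, then the graph
at `r` stays below all points near `z`. -/
theorem continuous_height
    (hind : ∀ l k q : ℤ, (l : ℝ) + k * ω + q * ρ = 0 → k = 0 ∧ q = 0) :
    Continuous L.height := by
  refine continuous_iff_lower_upperSemicontinuous.2 ⟨fun z s hs => ?_, fun z s hs => ?_⟩
  · obtain ⟨y, hy, hsy⟩ := exists_lt_of_lt_csSup (L.nonempty_height z) hs
    obtain ⟨r, hsr, hry⟩ := exists_between hsy
    obtain ⟨c, hc, hcz⟩ := exists_between
      ((L.upperEnvelope_supGraph_lt hind z.1 hry).trans_le hy)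
    have hcont : ContinuousAt (fun w : Circ × ℝ => (w.1, r)) z := by fun_prop
    filter_upwards [hcont.eventually (L.locallyBddAbove_supGraph.eventually_lt hc),
      continuousAt_snd.eventually_const_lt hcz] with w h1 h2
    exact hsr.trans_le (le_csSup (L.bddAbove_height w) (h1.trans h2).le)
  · obtain ⟨r, hr, hrs⟩ := exists_between hs
    have h1 : z.2 < L.supGraph (z.1, r) := by
      by_contra! h
      exact absurd (le_csSup (L.bddAbove_height z) h) (not_le.2 hr)
    obtain ⟨c, hzc, hc⟩ := exists_between h1
    have hcont : ContinuousAt (fun w : Circ × ℝ => (w.1, r)) z := by fun_prop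
    filter_upwards [hcont.eventually (L.lowerSemicontinuous_supGraph (z.1, r) c hc),
      continuousAt_snd.eventually_lt_const hzc] with w h2 h3
    refine lt_of_le_of_lt (csSup_le (L.nonempty_height w) fun y hy => ?_) hrs
    by_contra! hlt
    exact absurd ((L.supGraph_mono w.1 hlt.le).trans hy) (not_le.2 (h3.trans h2))

end RegularLift

theorem isQuotientMap_proj : IsQuotientMap proj :=
  isOpenMap_proj.isQuotientMap proj.continuous fun z => by
    obtain ⟨x, hx⟩ := QuotientAddGroup.mk_surjective z.2
    exact ⟨(z.1, x), Prod.ext rfl hx⟩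

/-- A regular forced circle homeomorphism whose rotation numbers are rationally independent is
semi-conjugate to the torus translation. -/
theorem ForcedCircleHomeo.IsRegular.exists_semiconjugacy {T : ForcedCircleHomeo}
    (hT : T.IsRegular) (hdep : ¬ RationallyDependent T.rotationNumber (T.ω : Circ)) :
    ∃ h : Torus → Torus,
      IsSemiconjugacy h T.toMap (translation (T.ω : Circ) T.rotationNumber) ∧
      (∀ z, (h z).1 = z.1) ∧ ∀ θ, IsOrderPreservingCircleMap fun x => (h (θ, x)).2 := by
  obtain ⟨L, hL⟩ := hT.exists_regularLift
  have hind : ∀ l k q : ℤ, (l : ℝ) + k * T.ω + q * liftRotationNumber T.someLift = 0 →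
      k = 0 ∧ q = 0 := by
    intro l k q h
    by_contra hkq
    -- The rotation number is the first argument of `RationallyDependent`, hence the exchange of `k`
    -- and `q`.
    refine hdep ⟨_, _, rfl, rfl, l, q, k, fun h0 => hkq ?_, by rw [← h]; ring⟩
    simp only [Prod.mk.injEq] at h0
    exact ⟨h0.2.2, h0.2.1⟩
  have hc := L.continuous_height hind
  let g : Circ → CircleDeg1Lift := fun θ =>
    ⟨⟨fun x => L.height (θ, x), L.height_mono θ⟩, L.height_add_one θ⟩
  have hg : ∀ θ x, g θ x = L.height (θ, x) := fun _ _ => rfl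
  let h : Torus → Torus := fun z => (z.1, ((L.height (z.1, Quotient.out z.2) : ℝ) : Circ))
  -- The representative chosen by `Quotient.out` is immaterial, because the height commutes with
  -- integer translations.
  have hproj : ∀ z : Circ × ℝ, h (proj z) = (z.1, ((L.height z : ℝ) : Circ)) := by
    intro z
    refine Prod.ext rfl ?_
    change ((L.height (z.1, Quotient.out (z.2 : Circ)) : ℝ) : Circ) = ((L.height z : ℝ) : Circ)
    have hout : ((Quotient.out (z.2 : Circ) : ℝ) : Circ) = (z.2 : Circ) := Quotient.out_eq _
    obtain ⟨m, hm⟩ := coe_eq_coe_iff.1 hout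
    rw [hm]
    have := (g z.1).map_add_int z.2 m
    rw [hg, hg] at this
    rw [this, coe_add_intCast]
  refine ⟨h, ⟨?_, ?_, ?_⟩, fun z => rfl, fun θ => ⟨g θ, ?_, ?_⟩⟩
  · rw [isQuotientMap_proj.continuous_iff]
    have : h ∘ proj = fun z => (z.1, ((L.height z : ℝ) : Circ)) := funext hproj
    rw [this]
    exact continuous_fst.prodMk ((AddCircle.continuous_mk' (1 : ℝ)).comp hc)
  · rintro ⟨θ, y⟩
    obtain ⟨y, rfl⟩ := QuotientAddGroup.mk_surjective y
    obtain ⟨x, hx⟩ := (hc.comp (by fun_prop : Continuous fun x : ℝ => (θ, x))).surjective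
      (g θ).tendsto_atTop (g θ).tendsto_atBot y
    refine ⟨proj (θ, x), (hproj _).trans (Prod.ext rfl ?_)⟩
    exact congrArg (fun r : ℝ => (r : Circ)) hx
  · intro z
    obtain ⟨w, rfl⟩ := isQuotientMap_proj.surjective z
    rw [← hL, hproj, hproj, L.height_apply, L.isFibredShift.fst_apply]
    rfl
  · exact hc.comp (by fun_prop : Continuous fun x : ℝ => (θ, x))
  · intro x
    exact congrArg Prod.snd (hproj (θ, x))

/-! ### Resonances in lowest terms. -/

/-- A rational relation `p q ρ = p a ω + b` between `ρ` and `ω`, in lowest terms. -/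
structure Resonance (ω ρ : ℝ) where
  /-- the number of tube components -/
  p : ℕ
  /-- the number of arcs of a component in each fibre -/
  q : ℕ
  /-- the winding number of a component -/
  a : ℤ
  /-- the shift of the components under the dynamics -/
  b : ℤ
  p_pos : 0 < p
  q_pos : 0 < q
  coprime_a_q : IsCoprime a q
  coprime_b_p : IsCoprime b p
  relation : (p * q : ℝ) * ρ = p * a * ω + b

/-- Take the least `N > 0` with `Nρ = aω + b`, and set `p = gcd (a, N)`, `q = N / p`. A common
divisor of `b` and `p` divides `N`, `a` and `b`, so minimality forces it to be `1`. -/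
theorem exists_resonance {ω ρ : ℝ}
    (h : ∃ N : ℕ, 0 < N ∧ ∃ a b : ℤ, (N : ℝ) * ρ = a * ω + b) : Nonempty (Resonance ω ρ) := by
  classical
  obtain ⟨hN, a, b, hab⟩ := Nat.find_spec h
  set N := Nat.find h with hNdef
  have hmin : ∀ M : ℕ, 0 < M → (∃ a b : ℤ, (M : ℝ) * ρ = a * ω + b) → N ≤ M :=
    fun M hM hM' => Nat.find_min' h ⟨hM, hM'⟩
  have hg : 0 < Int.gcd a N := Int.gcd_pos_of_ne_zero_right _ (by exact_mod_cast hN.ne')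
  obtain ⟨a', q', hcop, ha', hq'⟩ := Int.exists_gcd_one hg
  set p := Int.gcd a N with hp
  have hq0 : 0 < q' := by
    have : 0 < q' * (p : ℤ) := by rw [← hq']; exact_mod_cast hN
    exact pos_of_mul_pos_left this (by positivity)
  lift q' to ℕ using hq0.le
  have hNpq : N = q' * p := by exact_mod_cast hq'
  refine ⟨⟨p, q', a', b, hg, by exact_mod_cast hq0, Int.isCoprime_iff_gcd_eq_one.2 hcop, ?_, ?_⟩⟩
  · rw [Int.isCoprime_iff_gcd_eq_one]
    have hd0 : 0 < Int.gcd b p := Int.gcd_pos_of_ne_zero_right _ (by exact_mod_cast hg.ne')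
    obtain ⟨b', p', -, hb', hp'⟩ := Int.exists_gcd_one hd0
    set d := Int.gcd b p with hd
    have hp0 : 0 < p' := by
      have : 0 < p' * (d : ℤ) := by rw [← hp']; exact_mod_cast hg
      exact pos_of_mul_pos_left this (by positivity)
    lift p' to ℕ using hp0.le
    have hpd : p = p' * d := by exact_mod_cast hp'
    have hNd : N = q' * p' * d := by rw [hNpq, hpd, mul_assoc]
    have hle : N ≤ q' * p' := by
      refine hmin _ (by
        have h1 : 0 < q' := by exact_mod_cast hq0
        have h2 : 0 < p' := by exact_mod_cast hp0
        positivity) ⟨a' * p', b', ?_⟩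
      have hdR : (d : ℝ) ≠ 0 := by exact_mod_cast hd0.ne'
      refine mul_left_cancel₀ hdR ?_
      rw [hNd, ha', hb', hpd] at hab
      push_cast at hab ⊢
      linarith
    rw [hNd] at hle
    have h3 : 0 < q' * p' := by
      rcases Nat.eq_zero_or_pos (q' * p') with h0 | h0
      · rw [hNd, h0, zero_mul] at hN; omega
      · exact h0
    have h4 : d ≤ 1 := by
      by_contra! h5
      have := Nat.mul_le_mul_left (q' * p') h5
      omega
    omega
  · rw [hNpq, ha'] at hab
    push_cast at hab ⊢
    linarith

/-! ### Curves along a resonance and their separation. -/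

namespace RegularLift

variable {ω ρ : ℝ} (L : RegularLift ω ρ) (R : Resonance ω ρ)

/-- The invariant family of lower semicontinuous curves, indexed by `ℤ`. -/
def curve (j : ℤ) (t : ℝ) : ℝ :=
  L.supGraph ((t : Circ), R.a * t / R.q + j / (R.p * R.q))

/-- The upper envelopes of the curves. -/
def upperCurve (j : ℤ) : ℝ → ℝ := upperEnvelope (L.curve R j)

theorem continuous_line (j : ℤ) :
    Continuous fun t : ℝ => ((t : Circ), (R.a * t / R.q + j / (R.p * R.q) : ℝ)) :=
  (AddCircle.continuous_mk' (1 : ℝ)).prodMk (by fun_prop)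

theorem locallyBddAbove_curve (j : ℤ) : LocallyBddAbove (L.curve R j) :=
  L.locallyBddAbove_supGraph_comp (continuous_line R j)

theorem lowerSemicontinuous_curve (j : ℤ) : LowerSemicontinuous (L.curve R j) :=
  L.lowerSemicontinuous_supGraph.comp (continuous_line R j)

theorem curve_mono (t : ℝ) : Monotone fun j => L.curve R j t := fun i j hij =>
  L.supGraph_mono _ (by
    have : (i : ℝ) ≤ j := by exact_mod_cast hij
    gcongr)

/-- Three symmetries govern the index: `pq` is one unit of height, a turn around the base costs
`pa`, and the dynamics costs `b`. -/
theorem curve_add_mul (j k : ℤ) (t : ℝ) :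
    L.curve R (j + k * (R.p * R.q)) t = L.curve R j t + k := by
  have hp : (R.p : ℝ) ≠ 0 := by exact_mod_cast R.p_pos.ne'
  have hq : (R.q : ℝ) ≠ 0 := by exact_mod_cast R.q_pos.ne'
  unfold curve
  rw [← supGraph_add_intCast]
  congr 2
  push_cast
  field_simp
  ring

theorem curve_add_intCast (j m : ℤ) (t : ℝ) :
    L.curve R j (t + m) = L.curve R (j + m * (R.p * R.a)) t := by
  have hp : (R.p : ℝ) ≠ 0 := by exact_mod_cast R.p_pos.ne'
  have hq : (R.q : ℝ) ≠ 0 := by exact_mod_cast R.q_pos.ne'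
  unfold curve
  rw [coe_add_intCast]
  congr 2
  push_cast
  field_simp
  ring

/-- The resonance says exactly that `aω/q + b/(pq) = ρ`. -/
theorem curve_translate (j : ℤ) (t : ℝ) :
    L.curve R (j + R.b) (t + ω) = (L.Φ ((t : Circ), L.curve R j t)).2 := by
  have hp : (R.p : ℝ) ≠ 0 := by exact_mod_cast R.p_pos.ne'
  have hq : (R.q : ℝ) ≠ 0 := by exact_mod_cast R.q_pos.ne'
  unfold curve
  rw [← supGraph_translate, AddCircle.coe_add]
  congr 2
  have := R.relation
  push_cast
  field_simp
  linarith

theorem curve_le_upperCurve (j : ℤ) (t : ℝ) : L.curve R j t ≤ L.upperCurve R j t :=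
  (L.locallyBddAbove_curve R j).le_upperEnvelope t

theorem upperCurve_add_mul (j k : ℤ) (t : ℝ) :
    L.upperCurve R (j + k * (R.p * R.q)) t = L.upperCurve R j t + k := by
  unfold upperCurve
  rw [← (L.locallyBddAbove_curve R j).upperEnvelope_map (G := fun _ x => x + k)
    (by fun_prop) (fun z => strictMono_id.add_const _) t]
  congr 1
  ext t
  exact L.curve_add_mul R j k t

theorem upperCurve_add_intCast (j m : ℤ) (t : ℝ) :
    L.upperCurve R j (t + m) = L.upperCurve R (j + m * (R.p * R.a)) t := by
  unfold upperCurve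
  refine (upperEnvelope_comp_homeomorph (L.curve R j) (Homeomorph.addRight (m : ℝ)) t).symm.trans ?_
  congr 1
  ext t
  exact L.curve_add_intCast R j m t

theorem upperCurve_translate (j : ℤ) (t : ℝ) :
    L.upperCurve R (j + R.b) (t + ω) = (L.Φ ((t : Circ), L.upperCurve R j t)).2 := by
  unfold upperCurve
  have hc : Continuous fun z : ℝ × ℝ => (L.Φ ((z.1 : Circ), z.2)).2 :=
    continuous_snd.comp (L.Φ.continuous.comp
      (((AddCircle.continuous_mk' (1 : ℝ)).comp continuous_fst).prodMk continuous_snd))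
  rw [← (L.locallyBddAbove_curve R j).upperEnvelope_map
    (G := fun t x => (L.Φ ((t : Circ), x)).2) hc (fun t => L.isFibredShift.strictMono _) t]
  refine (upperEnvelope_comp_homeomorph (L.curve R (j + R.b)) (Homeomorph.addRight ω) t).symm.trans
    ?_
  congr 1
  ext t
  exact L.curve_translate R j t

/-- The `j`-th curve touches the next one above `t`. -/
def Touches (j : ℤ) (t : ℝ) : Prop := L.curve R (j + 1) t ≤ L.upperCurve R j t

theorem touches_add_mul (j k : ℤ) (t : ℝ) :
    L.Touches R (j + k * (R.p * R.q)) t ↔ L.Touches R j t := by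
  unfold Touches
  rw [add_right_comm, curve_add_mul, upperCurve_add_mul]
  exact add_le_add_iff_right _

theorem touches_add_intCast (j m : ℤ) (t : ℝ) :
    L.Touches R j (t + m) ↔ L.Touches R (j + m * (R.p * R.a)) t := by
  unfold Touches
  rw [curve_add_intCast, upperCurve_add_intCast, add_right_comm]

theorem touches_translate (j n : ℤ) (t : ℝ) :
    L.Touches R (j + n * R.b) (t + n * ω) ↔ L.Touches R j t := by
  have step : ∀ j t, L.Touches R (j + R.b) (t + ω) ↔ L.Touches R j t := by
    intro j t
    unfold Touches
    rw [add_right_comm, curve_translate, upperCurve_translate]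
    exact (L.isFibredShift.strictMono _).le_iff_le
  induction n with
  | zero => simp
  | succ n ih =>
    refine Iff.trans (iff_of_eq (congrArg₂ (L.Touches R) ?_ ?_)) ((step _ _).trans ih)
    · ring
    · push_cast; ring
  | pred n ih =>
    refine Iff.trans ((step _ _).symm.trans (iff_of_eq (congrArg₂ (L.Touches R) ?_ ?_))) ih
    · ring
    · push_cast; ring

/-- A single contact spreads to every index by coprimality, then to every base point by
irrationality of `ω`. Curve `pq` is curve `0` raised by `1`, so a chain of `pq` contacts is
impossible. -/
theorem upperCurve_lt_curve (j : ℤ) (t : ℝ) : L.upperCurve R j t < L.curve R (j + 1) t := by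
  by_contra! h0
  change L.Touches R j t at h0
  have hp : (R.p : ℝ) ≠ 0 := by exact_mod_cast R.p_pos.ne'
  have hq : (R.q : ℝ) ≠ 0 := by exact_mod_cast R.q_pos.ne'
  obtain ⟨x, y, hxy⟩ := R.coprime_b_p
  obtain ⟨u, v, huv⟩ := R.coprime_a_q
  -- With `xb + yp = 1` and `ua + vq = 1`, the shift `i - j` is an integer combination of `b`, `pa`
  -- and `pq`.
  have hex : ∀ i, ∃ s, L.Touches R i s := by
    intro i
    refine ⟨t + (((i - j) * x : ℤ) : ℝ) * ω + ((-((i - j) * y * u) : ℤ) : ℝ), ?_⟩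
    rw [touches_add_intCast]
    refine Iff.mp ?_ h0
    rw [← L.touches_translate R j ((i - j) * x) t,
      ← L.touches_add_mul R (j + (i - j) * x * R.b) ((i - j) * y * v)]
    refine iff_of_eq (congrArg (fun k => L.Touches R k _) ?_)
    linear_combination (i - j) * hxy + (i - j) * y * R.p * huv
  have hall : ∀ i s, L.curve R (i + 1) s ≤ L.upperCurve R i s := by
    intro i
    refine le_upperEnvelope_of_dense (L.locallyBddAbove_curve R i)
      (L.lowerSemicontinuous_curve R (i + 1)) ?_
    obtain ⟨s, hs⟩ := hex i
    -- Moving the base point by integer combinations of `Nω` and `N` changes the index by multiples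
    -- of `pq` only, so contact at the fixed index `i` recurs densely.
    set N : ℝ := R.p * R.q with hN
    have hN0 : N ≠ 0 := mul_ne_zero hp hq
    have hd : Dense (AddSubgroup.closure {N * ω, N} : Set ℝ) := by
      rw [dense_addSubgroupClosure_pair_iff, mul_div_cancel_left₀ _ hN0]
      exact L.irrational
    rw [dense_iff_inter_open]
    rintro O hO ⟨r, hr⟩
    obtain ⟨w, hw, hwO⟩ := hd.inter_open_nonempty _
      (hO.preimage (by fun_prop : Continuous fun w => s + w)) ⟨r - s, by simpa using hr⟩
    obtain ⟨n, m, rfl⟩ := AddSubgroup.mem_closure_pair.1 hwO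
    refine ⟨_, hw, ?_⟩
    change L.Touches R i (s + (n • (N * ω) + m • N))
    have hs' : s + (n • (N * ω) + m • N) = s + ((n * (R.p * R.q) : ℤ) : ℝ) * ω
        + ((m * (R.p * R.q) : ℤ) : ℝ) := by
      rw [hN]; push_cast; simp only [zsmul_eq_mul]; ring
    rw [hs', touches_add_intCast]
    refine Iff.mp ?_ hs
    rw [← L.touches_translate R i (n * (R.p * R.q)) s,
      ← L.touches_add_mul R (i + n * (R.p * R.q) * R.b) (m * (R.p * R.a) - n * R.b)]
    refine iff_of_eq (congrArg (fun k => L.Touches R k _) ?_)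
    ring
  obtain ⟨s, hs⟩ := exists_lt_of_chain (u := fun k : ℕ => L.curve R k)
    (fun k => L.locallyBddAbove_curve R k) (fun k => L.lowerSemicontinuous_curve R k)
    (K := R.p * R.q) (fun k _ s => by simpa using! hall k s) one_pos
  have := L.curve_add_mul R 0 1 s
  simp only [zero_add, one_mul, Int.cast_one] at this
  simp [this] at hs

end RegularLift

/-! ### Continuous selection. -/

/-- Between an upper and a lower semicontinuous function with the same quasi-period there is a
continuous function with that quasi-period. -/
theorem exists_continuous_between {u v : ℝ → ℝ} {T c : ℝ} (hT : 0 < T)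
    (hu : ∀ t s, u t < s → ∀ᶠ r in 𝓝 t, u r < s) (hv : LowerSemicontinuous v)
    (huv : ∀ t, u t < v t) (hu' : ∀ t, u (t + T) = u t + c) (hv' : ∀ t, v (t + T) = v t + c) :
    ∃ γ : ℝ → ℝ, Continuous γ ∧ (∀ t, γ (t + T) = γ t + c) ∧ ∀ t, u t < γ t ∧ γ t < v t := by
  have : Fact (0 < T) := ⟨hT⟩
  have hper : ∀ {f : ℝ → ℝ}, (∀ t, f (t + T) = f t + c) →
      Function.Periodic (fun t => f t - c * t / T) T := by
    intro f hf t
    simp only [hf]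
    field_simp
    ring
  -- Subtracting `ct/T` makes the constraints periodic. On the circle they are convex and, by
  -- semicontinuity, locally satisfied by constants, so a continuous selection exists.
  let S : AddCircle T → Set ℝ := fun z =>
    {x | ∀ t : ℝ, (t : AddCircle T) = z → u t - c * t / T < x ∧ x < v t - c * t / T}
  obtain ⟨g, hg⟩ := exists_continuous_forall_mem_convex_of_local_const (t := S) (by
      intro z
      have : S z = ⋂ t : ℝ, ⋂ _ : (t : AddCircle T) = z,
          Ioo (u t - c * t / T) (v t - c * t / T) := by
        ext x; simp [S]
      rw [this]
      exact convex_iInter fun t => convex_iInter fun _ => convex_Ioo _ _) (by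
      intro z
      obtain ⟨t, rfl⟩ := QuotientAddGroup.mk_surjective z
      obtain ⟨x, hx1, hx2⟩ := exists_between (sub_lt_sub_right (huv t) (c * t / T))
      refine ⟨x, ?_⟩
      obtain ⟨d, hd1, hd2⟩ := exists_between (show u t < x + c * t / T by linarith)
      obtain ⟨e, he1, he2⟩ := exists_between (show x + c * t / T < v t by linarith)
      have hc : ContinuousAt (fun r : ℝ => x + c * r / T) t := by fun_prop
      rw [show 𝓝 (QuotientAddGroup.mk t : AddCircle T) = map (↑) (𝓝 t) from
        QuotientAddGroup.nhds_eq _ t, eventually_map]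
      filter_upwards [hu t d hd1, hc.eventually_const_lt hd2, hc.eventually_lt_const he1,
        hv t e he2] with r h1 h2 h3 h4 t' ht'
      obtain ⟨m, hm⟩ := (AddCircle.coe_eq_zero_iff T).1
        (show ((t' - r : ℝ) : AddCircle T) = 0 by rw [AddCircle.coe_sub, ht', sub_self])
      obtain rfl : t' = r + m • T := by rw [hm]; ring
      have h5 := (hper hu').zsmul m r
      have h6 := (hper hv').zsmul m r
      rw [h5, h6]
      constructor <;> linarith)
  refine ⟨fun t => g (t : AddCircle T) + c * t / T, ?_, fun t => ?_, fun t => ?_⟩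
  · exact (g.continuous.comp (AddCircle.continuous_mk' T)).add (by fun_prop)
  · simp only [AddCircle.coe_add_period]
    field_simp
    ring
  · have := hg (t : AddCircle T) t rfl
    constructor <;> linarith [this.1, this.2]

/-! ### Gaps between the curves and their projections. -/

/-- The projection of the plane onto the torus. -/
def cover (z : ℝ × ℝ) : Torus := ((z.1 : Circ), (z.2 : Circ))

theorem isOpenMap_cover : IsOpenMap cover :=
  IsOpenMap.prodMap QuotientAddGroup.isOpenMap_coe QuotientAddGroup.isOpenMap_coe

theorem surjective_cover : Function.Surjective cover := by
  rintro ⟨θ, x⟩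
  obtain ⟨t, rfl⟩ := QuotientAddGroup.mk_surjective θ
  obtain ⟨x, rfl⟩ := QuotientAddGroup.mk_surjective x
  exact ⟨(t, x), rfl⟩

namespace RegularLift

variable {ω ρ : ℝ} (L : RegularLift ω ρ) (R : Resonance ω ρ)

theorem curve_strictMono (t : ℝ) : StrictMono fun j => L.curve R j t :=
  strictMono_int_of_lt_succ fun j =>
    (L.curve_le_upperCurve R j t).trans_lt (L.upperCurve_lt_curve R j t)

/-- The region between the `j`-th curve and the next one. -/
def gap (j : ℤ) : Set (ℝ × ℝ) := {z | L.upperCurve R j z.1 < z.2 ∧ z.2 < L.curve R (j + 1) z.1}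

theorem mem_gap {j : ℤ} {t x : ℝ} :
    (t, x) ∈ L.gap R j ↔ L.upperCurve R j t < x ∧ x < L.curve R (j + 1) t := Iff.rfl

theorem mem_gap_add_intCast {j m : ℤ} {t x : ℝ} :
    (t + m, x) ∈ L.gap R j ↔ (t, x) ∈ L.gap R (j + m * (R.p * R.a)) := by
  rw [mem_gap, mem_gap, upperCurve_add_intCast, curve_add_intCast, add_right_comm]

theorem mem_gap_add_mul {j k : ℤ} {t x : ℝ} :
    (t, x + k) ∈ L.gap R (j + k * (R.p * R.q)) ↔ (t, x) ∈ L.gap R j := by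
  rw [mem_gap, mem_gap, upperCurve_add_mul, add_right_comm, curve_add_mul, add_lt_add_iff_right,
    add_lt_add_iff_right]

theorem mem_gap_translate {j : ℤ} {t x : ℝ} :
    (t + ω, (L.Φ ((t : Circ), x)).2) ∈ L.gap R (j + R.b) ↔ (t, x) ∈ L.gap R j := by
  rw [mem_gap, mem_gap, upperCurve_translate, add_right_comm, curve_translate]
  have h := L.isFibredShift.strictMono (t : Circ)
  exact and_congr h.lt_iff_lt h.lt_iff_lt

theorem eq_of_mem_gap {i j : ℤ} {z : ℝ × ℝ} (hi : z ∈ L.gap R i) (hj : z ∈ L.gap R j) : i = j := by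
  have key : ∀ {i j : ℤ}, z ∈ L.gap R i → z ∈ L.gap R j → ¬ i < j := by
    intro i j hi hj hij
    have h1 := L.curve_mono R z.1 (show i + 1 ≤ j by omega)
    have h2 := L.curve_le_upperCurve R j z.1
    exact absurd (hi.2.trans_le (h1.trans h2)) (not_lt.2 hj.1.le)
  exact le_antisymm (not_lt.1 (key hj hi)) (not_lt.1 (key hi hj))

theorem isOpen_gap (j : ℤ) : IsOpen (L.gap R j) := by
  rw [isOpen_iff_eventually]
  rintro z ⟨h1, h2⟩
  obtain ⟨c, hc, hcz⟩ := exists_between h1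
  obtain ⟨d, hzd, hd⟩ := exists_between h2
  filter_upwards [continuousAt_fst.eventually
      ((L.locallyBddAbove_curve R j).eventually_upperEnvelope_lt hc),
    continuousAt_fst.eventually (L.lowerSemicontinuous_curve R (j + 1) z.1 d hd),
    continuousAt_snd.eventually_const_lt hcz, continuousAt_snd.eventually_lt_const hzd]
    with w h3 h4 h5 h6
  exact ⟨lt_trans h3 h5, h6.trans h4⟩

/-- Points of a gap that differ by an integer vector. -/
theorem dvd_sub_of_mem_gap {i m m' n : ℤ} {t x : ℝ} (h : (t + m, x) ∈ L.gap R i)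
    (h' : (t + m', x + n) ∈ L.gap R i) : (R.q : ℤ) ∣ m' - m := by
  rw [mem_gap_add_intCast] at h h'
  have h1 := (L.mem_gap_add_mul R (j := i + m * (R.p * R.a)) (k := n)).2 h
  have h2 := L.eq_of_mem_gap R h1 h'
  have hp : (R.p : ℤ) ≠ 0 := by exact_mod_cast R.p_pos.ne'
  have h3 : (m' - m) * R.a = n * R.q := by
    apply mul_left_cancel₀ hp
    linarith
  exact (R.coprime_a_q.symm).dvd_of_dvd_mul_right (Dvd.intro_left n h3.symm)

/-- The projection of a gap to the torus. -/
def tube (j : ℤ) : Set Torus := cover '' L.gap R j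

theorem isOpen_tube (j : ℤ) : IsOpen (L.tube R j) := isOpenMap_cover _ (L.isOpen_gap R j)

/-- Integer translations `(m, n)` change the index by `p(ma - nq)`. Since `a` and `q` are coprime,
these are exactly the multiples of `p`, so a tube depends only on `j` modulo `p`. -/
theorem mem_tube_iff {j : ℤ} {z : ℝ × ℝ} :
    cover z ∈ L.tube R j ↔ ∃ k : ℤ, z ∈ L.gap R (j + k * R.p) := by
  obtain ⟨t, x⟩ := z
  constructor
  · rintro ⟨⟨t', x'⟩, h, he⟩
    obtain ⟨m, hm⟩ := coe_eq_coe_iff.1 (congrArg Prod.fst he)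
    obtain ⟨n, hn⟩ := coe_eq_coe_iff.1 (congrArg Prod.snd he)
    simp only at hm hn
    subst hm hn
    rw [mem_gap_add_intCast] at h
    refine ⟨m * R.a - n * R.q, (L.mem_gap_add_mul R (k := n)).1 ?_⟩
    convert h using 2
    ring
  · rintro ⟨k, h⟩
    obtain ⟨u, v, huv⟩ := R.coprime_a_q
    refine ⟨(t + ((k * u : ℤ) : ℝ), x + ((-(k * v) : ℤ) : ℝ)), ?_,
      Prod.ext (coe_add_intCast _ _) (coe_add_intCast _ _)⟩
    rw [mem_gap_add_intCast]
    refine Iff.mp ?_ ((L.mem_gap_add_mul R (k := -(k * v))).2 h)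
    refine iff_of_eq (congrArg (fun i => _ ∈ L.gap R i) ?_)
    linear_combination (-k * R.p) * huv

theorem tube_add_mul (j k : ℤ) : L.tube R (j + k * R.p) = L.tube R j := by
  ext z
  obtain ⟨z, rfl⟩ := surjective_cover z
  rw [mem_tube_iff, mem_tube_iff]
  constructor
  · rintro ⟨l, h⟩
    exact ⟨k + l, by rwa [add_mul, ← add_assoc]⟩
  · rintro ⟨l, h⟩
    exact ⟨l - k, by rwa [sub_mul, add_assoc, add_sub_cancel]⟩

/-- Each gap contains a `q`-curve. -/
theorem exists_qCurve (j : ℤ) : ∃ γ : ℝ → ℝ, IsQCurve R.q γ ∧ ∀ t, (t, γ t) ∈ L.gap R j := by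
  obtain ⟨γ, hγ, hper, hmem⟩ := exists_continuous_between (u := L.upperCurve R j)
    (v := L.curve R (j + 1)) (T := R.q) (c := R.a) (by exact_mod_cast R.q_pos)
    (fun t s h => (L.locallyBddAbove_curve R j).eventually_upperEnvelope_lt h)
    (L.lowerSemicontinuous_curve R (j + 1)) (L.upperCurve_lt_curve R j)
    (fun t => by
      have := L.upperCurve_add_intCast R j R.q t
      rw [Int.cast_natCast] at this
      rw [this, ← upperCurve_add_mul]
      congr 1; ring)
    (fun t => by
      have := L.curve_add_intCast R (j + 1) R.q t
      rw [Int.cast_natCast] at this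
      rw [this, ← curve_add_mul]
      congr 1; ring)
  refine ⟨γ, ⟨hγ, ⟨R.a, hper⟩, fun t l hl hlq n hn => ?_⟩, hmem⟩
  have h1 : (t + ((0 : ℤ) : ℝ), γ t) ∈ L.gap R j := by
    rw [Int.cast_zero, add_zero]; exact hmem t
  have h2 : (t + ((l : ℤ) : ℝ), γ t + n) ∈ L.gap R j := by
    rw [← hn, add_sub_cancel, Int.cast_natCast]
    exact hmem (t + l)
  have h3 := Int.le_of_dvd (by omega) (L.dvd_sub_of_mem_gap R h1 h2)
  omega

/-- As `b` is invertible modulo `p`, the first `p` images of a tube have distinct residues. -/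
theorem fin_eq_of_modEq {i i' : Fin R.p} {k k' : ℤ}
    (h : (i : ℕ) * R.b + k * R.p = (i' : ℕ) * R.b + k' * R.p) : i = i' := by
  have h1 : (R.p : ℤ) ∣ ((i : ℕ) - (i' : ℕ) : ℤ) * R.b := ⟨k' - k, by linarith⟩
  have h2 := (R.coprime_b_p.symm).dvd_of_dvd_mul_right h1
  have h3 := Int.eq_zero_of_abs_lt_dvd h2 (by
    have := i.2; have := i'.2; rw [abs_lt]; constructor <;> omega)
  exact Fin.ext (by omega)

/-! ### Dynamics of the tubes, the strip and the graph. -/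

section Dynamics

variable {S : Torus → Torus} (hS : ∀ z, proj (L.Φ z) = S (proj z))
include hS

theorem map_cover (z : ℝ × ℝ) : S (cover z) = cover (z.1 + ω, (L.Φ ((z.1 : Circ), z.2)).2) := by
  refine (hS ((z.1 : Circ), z.2)).symm.trans (Prod.ext ?_ rfl)
  exact L.isFibredShift.fst_apply _

theorem surjective_of_lift : Function.Surjective S := by
  intro z
  obtain ⟨w, rfl⟩ := isQuotientMap_proj.surjective z
  exact ⟨proj (L.Φ.symm w), by rw [← hS, Homeomorph.apply_symm_apply]⟩

theorem preimage_tube (j : ℤ) : S ⁻¹' L.tube R (j + R.b) = L.tube R j := by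
  ext z
  obtain ⟨z, rfl⟩ := surjective_cover z
  rw [mem_preimage, L.map_cover hS, mem_tube_iff, mem_tube_iff]
  refine exists_congr fun k => ?_
  rw [add_right_comm, mem_gap_translate]

theorem image_tube (j : ℤ) : S '' L.tube R j = L.tube R (j + R.b) := by
  rw [← L.preimage_tube R hS, image_preimage_eq _ (L.surjective_of_lift hS)]

theorem image_iterate_tube (i : ℕ) (j : ℤ) :
    S^[i] '' L.tube R j = L.tube R (j + i * R.b) := by
  induction i with
  | zero => simp
  | succ i ih =>
    rw [Function.iterate_succ', image_comp, ih, L.image_tube R hS]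
    congr 1
    push_cast
    ring

/-- Invertibility of `b` modulo `p` makes the images of tube `0` run through all residues, hence
through all gaps. -/
theorem cover_mem_tubeOf_iff {z : ℝ × ℝ} :
    cover z ∈ tubeOf S R.p (L.tube R 0) ↔ ∃ j, z ∈ L.gap R j := by
  simp only [tubeOf, mem_iUnion, L.image_iterate_tube R hS, mem_tube_iff]
  constructor
  · rintro ⟨i, k, h⟩
    exact ⟨_, h⟩
  · rintro ⟨j, h⟩
    have hp : (0 : ℤ) < R.p := by exact_mod_cast R.p_pos
    obtain ⟨x, y, hxy⟩ := R.coprime_b_p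
    have h0 := Int.emod_nonneg (j * x) hp.ne'
    have h1 := Int.emod_lt_of_pos (j * x) hp
    have h2 := Int.emod_add_mul_ediv (j * x) R.p
    set r := (j * x) % (R.p : ℤ) with hr
    refine ⟨⟨r.toNat, by omega⟩, j * x / R.p * R.b + j * y, ?_⟩
    convert h using 2
    simp only
    rw [Int.toNat_of_nonneg h0]
    linear_combination R.b * h2 + j * hxy

theorem preimage_tubeOf :
    S ⁻¹' tubeOf S R.p (L.tube R 0) = tubeOf S R.p (L.tube R 0) := by
  ext z
  obtain ⟨z, rfl⟩ := surjective_cover z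
  rw [mem_preimage, L.map_cover hS, L.cover_mem_tubeOf_iff R hS, L.cover_mem_tubeOf_iff R hS]
  constructor
  · rintro ⟨j, h⟩
    exact ⟨j - R.b, (L.mem_gap_translate R).1 (by rwa [sub_add_cancel])⟩
  · rintro ⟨j, h⟩
    exact ⟨j + R.b, (L.mem_gap_translate R).2 h⟩

theorem isOneTube (j : ℤ) : IsOneTube S^[R.p] R.q (L.tube R j) := by
  refine ⟨L.isOpen_tube R j, ?_, ?_⟩
  · rw [L.image_iterate_tube R hS, mul_comm, tube_add_mul]
  obtain ⟨γ, hγ, hmem⟩ := L.exists_qCurve R j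
  refine ⟨γ, hγ, fun t => ⟨fun i => (fun x : ℝ => (x : Circ)) ''
    Ioo (L.upperCurve R j (t + (i : ℕ))) (L.curve R (j + 1) (t + (i : ℕ))), fun i => ?_,
    fun i i' hne => ?_, ?_, fun i => ⟨_, hmem _, rfl⟩⟩⟩
  -- The arc has length at most `1` because curve `j + 1` lies on or below curve `j + pq`, which is
  -- curve `j` raised by `1`.
  · refine ⟨_, _, L.upperCurve_lt_curve R j _, ?_, rfl⟩
    have h1 := L.curve_add_mul R j 1 (t + (i : ℕ))
    have h2 := L.curve_le_upperCurve R j (t + (i : ℕ))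
    have hpq : 0 < R.p * R.q := Nat.mul_pos R.p_pos R.q_pos
    have h3 := L.curve_mono R (t + (i : ℕ)) (show j + 1 ≤ j + 1 * (R.p * R.q) by
      have : (0 : ℤ) < R.p * R.q := by exact_mod_cast hpq
      omega)
    simp only [Int.cast_one] at h1 h3
    linarith
  · refine Set.disjoint_left.2 ?_
    rintro _ ⟨x, hx, rfl⟩ ⟨x', hx', he⟩
    obtain ⟨n, rfl⟩ := coe_eq_coe_iff.1 he
    have h1 : (t + (((i : ℕ) : ℤ) : ℝ), x) ∈ L.gap R j := by rw [Int.cast_natCast]; exact hx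
    have h2 : (t + (((i' : ℕ) : ℤ) : ℝ), x + n) ∈ L.gap R j := by
      rw [Int.cast_natCast]; exact hx'
    have h3 := Int.eq_zero_of_abs_lt_dvd (L.dvd_sub_of_mem_gap R h1 h2) (by
      have := i.2; have := i'.2; rw [abs_lt]; constructor <;> omega)
    exact hne (Fin.ext (by omega))
  · ext c
    obtain ⟨x, rfl⟩ := QuotientAddGroup.mk_surjective c
    simp only [mem_iUnion]
    constructor
    · rintro ⟨⟨t', x'⟩, h, he⟩
      obtain ⟨m, hm⟩ := coe_eq_coe_iff.1 (congrArg Prod.fst he)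
      obtain ⟨n, hn⟩ := coe_eq_coe_iff.1 (congrArg Prod.snd he)
      simp only at hm hn
      subst hm hn
      have hq : (0 : ℤ) < R.q := by exact_mod_cast R.q_pos
      have h0 := Int.emod_nonneg m hq.ne'
      have h1 := Int.emod_lt_of_pos m hq
      have h2 := Int.emod_add_mul_ediv m R.q
      set r := m % (R.q : ℤ) with hr
      set k := m / (R.q : ℤ) with hk
      -- Write `m = r + kq`. Every `q` turns raise the gap by `a`, so undoing `k` such rounds
      -- subtracts `ka`.
      refine ⟨⟨r.toNat, by omega⟩, x + n + ((-(k * R.a) : ℤ) : ℝ), ?_, ?_⟩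
      · have hr' : ((r.toNat : ℕ) : ℝ) = ((r : ℤ) : ℝ) := by
          rw [← Int.cast_natCast, Int.toNat_of_nonneg h0]
        simp only [hr']
        change (t + (r : ℝ), x + n + ((-(k * R.a) : ℤ) : ℝ)) ∈ L.gap R j
        rw [mem_gap_add_intCast, ← L.mem_gap_add_mul R (k := k * R.a)]
        rw [mem_gap_add_intCast] at h
        convert h using 2
        · linear_combination (R.p * R.a : ℤ) * h2
        · push_cast; ring
      · change ((x + n + ((-(k * R.a) : ℤ) : ℝ) : ℝ) : Circ) = (x : Circ)
        rw [coe_add_intCast, coe_add_intCast]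
    · rintro ⟨i, x', hx', he⟩
      refine ⟨(t + (i : ℕ), x'), hx', Prod.ext ?_ he⟩
      exact coe_eq_coe_iff.2 ⟨(i : ℕ), by simp⟩

theorem isTubeComponent : IsTubeComponent S R.p R.q (L.tube R 0) := by
  refine ⟨R.p_pos, R.q_pos, L.isOneTube R hS 0, fun i i' hne => ?_⟩
  refine Set.disjoint_left.2 fun z hz hz' => ?_
  obtain ⟨z, rfl⟩ := surjective_cover z
  rw [L.image_iterate_tube R hS, mem_tube_iff] at hz hz'
  obtain ⟨k, hk⟩ := hz
  obtain ⟨k', hk'⟩ := hz'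
  have := L.eq_of_mem_gap R hk hk'
  rw [zero_add, zero_add] at this
  exact hne (fin_eq_of_modEq R this)

theorem isInvariantStrip : IsInvariantStrip S R.p R.q (tubeOf S R.p (L.tube R 0))ᶜ := by
  refine ⟨IsClosed.isCompact ?_, ?_, L.tube R 0, L.isTubeComponent R hS, compl_compl _⟩
  · rw [isClosed_compl_iff]
    refine isOpen_iUnion fun i => ?_
    rw [L.image_iterate_tube R hS]
    exact L.isOpen_tube R _
  · conv_lhs => rw [← L.preimage_tubeOf R hS, ← preimage_compl]
    exact image_preimage_eq _ (L.surjective_of_lift hS)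

/-- Going up from a point of gap `m`, one stays in the gap until curve `m + 1`, whose points lie in
no gap. The distance is less than `1` because `x` is strictly above curve `m`. -/
theorem sInf_eq_curve_sub {m : ℤ} {t x : ℝ} (h : (t, x) ∈ L.gap R m) :
    sInf {y ∈ Ico (0 : ℝ) 1 |
      ((x + y : ℝ) : Circ) ∉ fibre (tubeOf S R.p (L.tube R 0)) (t : Circ)}
      = L.curve R (m + 1) t - x := by
  have hfib : ∀ y : ℝ, (y : Circ) ∈ fibre (tubeOf S R.p (L.tube R 0)) (t : Circ) ↔
      ∃ j, (t, y) ∈ L.gap R j := fun y => L.cover_mem_tubeOf_iff R hS (z := (t, y))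
  refine IsLeast.csInf_eq ⟨⟨⟨?_, ?_⟩, ?_⟩, ?_⟩
  · linarith [h.2]
  · have h1 := L.curve_add_mul R m 1 t
    have h2 := L.curve_le_upperCurve R m t
    have hpq : 0 < R.p * R.q := Nat.mul_pos R.p_pos R.q_pos
    have h3 := L.curve_mono R t (show m + 1 ≤ m + 1 * (R.p * R.q) by
      have : (0 : ℤ) < R.p * R.q := by exact_mod_cast hpq
      omega)
    have h4 : L.upperCurve R m t < x := h.1
    simp only [Int.cast_one] at h1 h3
    linarith
  · rw [hfib, add_sub_cancel]
    rintro ⟨j, hj1, hj2⟩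
    have h1 := (L.curve_strictMono R t).lt_iff_lt.1 hj2
    have h2 := L.curve_mono R t (show m + 1 ≤ j by omega)
    have h3 := L.curve_le_upperCurve R j t
    exact absurd hj1 (not_lt.2 (h2.trans h3))
  · rintro y ⟨hy, hyU⟩
    by_contra! hlt
    rw [hfib] at hyU
    refine hyU ⟨m, ?_, ?_⟩
    · have h4 : L.upperCurve R m t < x := h.1
      change L.upperCurve R m t < x + y
      linarith [hy.1]
    · change x + y < L.curve R (m + 1) t
      linarith

theorem exists_regularInvariantGraph :
    ∃ φ : Circ → Fin R.p → Fin R.q → Circ, IsRegularInvariantGraph S R.p R.q φ := by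
  let rep : Circ → ℝ := fun θ => AddCircle.equivIco (1 : ℝ) 0 θ
  have hrep : ∀ t ∈ Ico (0 : ℝ) 1, rep (t : Circ) = t := fun t ht =>
    AddCircle.equivIco_coe_of_mem (by simpa using ht)
  -- The `i`-th image contributes `ib`, and moving `j` turns along the base contributes `jpa`.
  let idx : Fin R.p → Fin R.q → ℤ := fun i j => (i : ℕ) * R.b + (j : ℕ) * (R.p * R.a)
  choose γ hγ hmem using fun i : Fin R.p => L.exists_qCurve R ((i : ℕ) * R.b)
  refine ⟨fun θ i j => ((L.curve R (idx i j + 1) (rep θ) : ℝ) : Circ), ?_, L.tube R 0,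
    L.isTubeComponent R hS, γ, hγ, ?_, Or.inl ?_⟩
  · rintro θ ⟨i, j⟩ ⟨i', j'⟩ h
    obtain ⟨n, hn⟩ := coe_eq_coe_iff.1 h
    rw [← curve_add_mul] at hn
    have h1 := (L.curve_strictMono R (rep θ)).injective hn
    simp only [idx] at h1
    obtain rfl : i = i' := fin_eq_of_modEq R (k := (j : ℕ) * R.a)
      (k' := (j' : ℕ) * R.a + n * R.q) (by linarith)
    have hp : (R.p : ℤ) ≠ 0 := by exact_mod_cast R.p_pos.ne'
    have h2 : (((j : ℕ) : ℤ) - (j' : ℕ)) * R.a = n * R.q := by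
      apply mul_left_cancel₀ hp
      linarith
    have h3 := (R.coprime_a_q.symm).dvd_of_dvd_mul_right (Dvd.intro_left n h2.symm)
    have h4 := Int.eq_zero_of_abs_lt_dvd h3 (by
      have := j.2; have := j'.2; rw [abs_lt]; constructor <;> omega)
    exact Prod.ext rfl (Fin.ext (by simp only; omega))
  · intro i t
    rw [L.image_iterate_tube R hS, zero_add]
    exact ⟨(t, γ i t), hmem i t, rfl⟩
  · intro t ht i j
    have h := hmem i (t + (j : ℕ))
    rw [← Int.cast_natCast (R := ℝ) (j : ℕ), mem_gap_add_intCast] at h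
    rw [← Int.cast_natCast (R := ℝ) (j : ℕ), L.sInf_eq_curve_sub R hS h, add_sub_cancel]
    simp only [hrep t ht, idx]

end Dynamics

end RegularLift

/-- A regular forced circle homeomorphism with rationally dependent rotation numbers has an
invariant strip and a regular invariant graph. -/
theorem ForcedCircleHomeo.IsRegular.exists_strip_and_graph {T : ForcedCircleHomeo}
    (hT : T.IsRegular) (hdep : RationallyDependent T.rotationNumber (T.ω : Circ)) :
    ∃ p q : ℕ, 0 < p ∧ 0 < q ∧ (∃ A : Set Torus, IsInvariantStrip T.toMap p q A) ∧
      ∃ φ : Circ → Fin p → Fin q → Circ, IsRegularInvariantGraph T.toMap p q φ := by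
  obtain ⟨L, hL⟩ := hT.exists_regularLift
  generalize hρ : liftRotationNumber T.someLift = ρ at L
  have hres : ∃ N : ℕ, 0 < N ∧ ∃ a b : ℤ, (N : ℝ) * ρ = a * T.ω + b := by
    obtain ⟨r, w, hr, hw, l, k, q, hne, hrel⟩ := hdep
    obtain ⟨m, rfl⟩ := coe_eq_coe_iff.1 (show (r : Circ) = (ρ : Circ) by rw [← hρ]; exact hr)
    obtain ⟨m', rfl⟩ := coe_eq_coe_iff.1 hw
    -- Here `k` is the coefficient of `ρ`; were it zero, `ω` would be rational.
    have hk : k ≠ 0 := by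
      rintro rfl
      have hq : q ≠ 0 := by
        rintro rfl
        simp only [Int.cast_zero, zero_mul, add_zero, Int.cast_eq_zero] at hrel
        exact hne (by rw [hrel])
      have hqR : (q : ℝ) ≠ 0 := by exact_mod_cast hq
      refine T.irrational_ω.ne_rat ((-(l + q * m') : ℤ) / q : ℚ) ?_
      push_cast
      rw [eq_div_iff hqR]
      push_cast at hrel
      linarith
    rcases lt_or_gt_of_ne hk with h | h
    · refine ⟨(-k).toNat, by omega, q, l + k * m + q * m', ?_⟩
      have : (((-k).toNat : ℕ) : ℝ) = ((-k : ℤ) : ℝ) := by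
        rw [← Int.cast_natCast, Int.toNat_of_nonneg (by omega)]
      rw [this]
      push_cast
      linarith
    · refine ⟨k.toNat, by omega, -q, -(l + k * m + q * m'), ?_⟩
      have : ((k.toNat : ℕ) : ℝ) = ((k : ℤ) : ℝ) := by
        rw [← Int.cast_natCast, Int.toNat_of_nonneg (by omega)]
      rw [this]
      push_cast
      linarith
  obtain ⟨R⟩ := exists_resonance hres
  exact ⟨R.p, R.q, R.p_pos, R.q_pos, ⟨_, L.isInvariantStrip R hL⟩,
    L.exists_regularInvariantGraph R hL⟩

end QPF

end

theorem mainTheorem1 (T : QPF.ForcedCircleHomeo) (hT : T.IsRegular) :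
    (QPF.RationallyDependent T.rotationNumber (T.ω : QPF.Circ) →
      ∃ p q : ℕ, 0 < p ∧ 0 < q ∧
        (∃ A : Set QPF.Torus, QPF.IsInvariantStrip T.toMap p q A) ∧
        ∃ φ : QPF.Circ → Fin p → Fin q → QPF.Circ,
          QPF.IsRegularInvariantGraph T.toMap p q φ) ∧
    (¬ QPF.RationallyDependent T.rotationNumber (T.ω : QPF.Circ) →
      ∃ h : QPF.Torus → QPF.Torus,
        QPF.IsSemiconjugacy h T.toMap (QPF.translation (T.ω : QPF.Circ) T.rotationNumber) ∧
        (∀ z, (h z).1 = z.1) ∧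
        ∀ θ, QPF.IsOrderPreservingCircleMap fun x => (h (θ, x)).2) :=
  ⟨hT.exists_strip_and_graph, hT.exists_semiconjugacy⟩
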